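/- Let $k,n\ge 1$ be integers, $0<s<1$, $0<\theta<1$ and $1\le p,q,r\le\infty$ with $$\frac1p+\frac sq\le\frac1r\qquad\Big(\frac1\infty:=0\Big),$$ and let either $0<\beta<\theta s$, or $\beta=\theta s$ and ($r=\infty$, or $r<\infty$ and $q=sr$). Notation. For a bounded domain $G\subset\mathbb R^k$, $0<\delta<1$ and a function $u$ on $G$ put $$[u]_{\delta,\ell}=\Big(\int_G\int_G\frac{|u(x)-u(y)|^\ell}{|x-y|^{k+\delta\ell}}\,dy\,dx\Big)^{1/\ell}\ (1\le\ell<\infty),\qquad [u]_{\delta,\infty}=\sup_{x,y\in G,\ x\ne y}\frac{|u(y)-u(x)|}{|y-x|^\delta}.$$ $W^{\delta,\ell}(G,\mathbb R^n)$ is the space of $u\in L^\ell(G,\mathbb R^n)$ with $[u]_{\delta,\ell}<\infty$ if $\ell<\infty$, and the space of bounded functions $u:G\to\mathbb R^n$ with $[u]_{\delta,\infty}<\infty$ if $\ell=\infty$. For $\varphi\in BV(\mathbb R^n)$ let $\|D\varphi\|$ be the total variation measure of its $\mathbb R^n$-valued gradient measure $D\varphi$, let $$U^{1-s}\|D\varphi\|(\xi)=\int_{\mathbb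 R^n}|\xi-\eta|^{1-s-n}\,\|D\varphi\|(d\eta)\in[0,\infty],$$ where the kernel is $+\infty$ for $\eta=\xi$, and for measurable $u:G\to\mathbb R^n$ let $V_{\varphi,s,p}(u)=\int_G\big(U^{1-s}\|D\varphi\|(u(x))\big)^p\,dx$ if $p<\infty$, and let $V_{\varphi,s,\infty}(u)$ be the essential supremum of $x\mapsto U^{1-s}\|D\varphi\|(u(x))$ over $G$. Let $S_\varphi$ be the set of points of $\mathbb R^n$ at which $\varphi$ has no approximate limit, that is, at which there is no $\lambda\in\mathbb R$ with $\lim_{\rho\to0}|B(\xi,\rho)|^{-1}\int_{B(\xi,\rho)}|\varphi(z)-\lambda|\,dz=0$. A Lebesgue representative of $\varphi$ is a Borel function $\widetilde\varphi:\mathbb R^n\to\mathbb R$ equal to the approximate limit of $\varphi$ at every point outside $S_\varphi$. Theorem. For every $R\in\mathbb R$ there is a constant $c>0$, depending only on $k,n,s,p,q,r,\beta,\theta$ and $R$, and not on $R$ if $\beta=\theta s$, such that the following holds for every bounded domain $G\subset\mathbb R^k$ of diameter at most $R$, every $\varphi\in BV(\mathbb R^n)$ and every $u\in W^{\theta,q}(G,\mathbb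 R^n)$ with $V_{\varphi,s,p}(u)<\infty$. First, $\mathcal L^k(\{x\in G:u(x)\in S_\varphi\})=0$, so that the composition $\varphi\circ u$ is well defined as the almost-everywhere equivalence class on $G$ of $\widetilde\varphi\circ u$, for an arbitrary Lebesgue representative $\widetilde\varphi$ of $\varphi$. Moreover, $$[\varphi\circ u]_{\beta,r}\le c\,[u]_{\theta,q}^s\,V_{\varphi,s,p}(u)^{1/p}\quad\text{if }p<\infty,\qquad [\varphi\circ u]_{\beta,r}\le c\,[u]_{\theta,q}^s\,V_{\varphi,s,\infty}(u)\quad\text{if }p=\infty,$$ where for $r=\infty$ the bound is meant for a suitable (the continuous) representative of the class $\varphi\circ u$. -/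

import Mathlib

open MeasureTheory Set Filter Topology
open scoped ENNReal NNReal

namespace NonlinearComposition

/-- `D` is the gradient measure of `φ`: an `ℝⁿ`-valued Borel measure of finite total variation
whose components are the distributional partial derivatives of `φ`, that is
`∫ φ ∂ᵢψ dx = - ∫ ψ dDᵢ` for all test functions `ψ` and all `i`. -/
structure IsGradientMeasure {n : ℕ} (φ : EuclideanSpace ℝ (Fin n) → ℝ)
    (D : VectorMeasure (EuclideanSpace ℝ (Fin n)) (EuclideanSpace ℝ (Fin n))) : Prop where
  finite_variation : D.variation univ < ∞
  integral_eq : ∀ ψ : EuclideanSpace ℝ (Fin n) → ℝ, ContDiff ℝ (⊤ : ℕ∞) ψ → HasCompactSupport ψ →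
    ∀ i : Fin n,
      ∫ x, φ x * fderiv ℝ ψ x (EuclideanSpace.single i 1) =
        - (D.integral ψ (ContinuousLinearMap.lsmul ℝ ℝ)) i

/-- `φ ∈ BV(ℝⁿ)`: `φ` is integrable and has a gradient measure. -/
def IsBV {n : ℕ} (φ : EuclideanSpace ℝ (Fin n) → ℝ) : Prop :=
  Integrable φ ∧ ∃ D, IsGradientMeasure φ D

open Classical in
/-- The gradient measure `Dφ` (which is unique) of a function of bounded variation;
zero if there is none. -/
noncomputable def gradientMeasure {n : ℕ} (φ : EuclideanSpace ℝ (Fin n) → ℝ) :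
    VectorMeasure (EuclideanSpace ℝ (Fin n)) (EuclideanSpace ℝ (Fin n)) :=
  if h : ∃ D, IsGradientMeasure φ D then h.choose else 0

/-- The Riesz potential `U^α ν (x) = ∫ |x - y|^(α - n) ν(dy)`, with values in `[0, ∞]`; for
`α < n` the kernel is `∞` on the diagonal. -/
noncomputable def rieszPotential {n : ℕ} (α : ℝ) (ν : Measure (EuclideanSpace ℝ (Fin n)))
    (x : EuclideanSpace ℝ (Fin n)) : ℝ≥0∞ :=
  ∫⁻ y, ‖x - y‖ₑ ^ (α - n) ∂ν

/-- The nonlinear energy `V_{φ,s,p}(u)` over `G`: the integral of the `p`-th power of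
`U^{1-s}‖Dφ‖(u(x))` for finite `p`, its essential supremum for `p = ∞`. -/
noncomputable def energy {k n : ℕ} (G : Set (EuclideanSpace ℝ (Fin k)))
    (φ : EuclideanSpace ℝ (Fin n) → ℝ) (s : ℝ) (p : ℝ≥0∞)
    (u : EuclideanSpace ℝ (Fin k) → EuclideanSpace ℝ (Fin n)) : ℝ≥0∞ :=
  if p = ∞ then
    essSup (fun x => rieszPotential (1 - s) (gradientMeasure φ).variation (u x))
      (volume.restrict G)
  else
    ∫⁻ x in G, rieszPotential (1 - s) (gradientMeasure φ).variation (u x) ^ p.toReal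

/-- The seminorm `[u]_{δ,ℓ}` over `G`: Gagliardo seminorm for finite `ℓ`, Hölder seminorm
for `ℓ = ∞`. -/
noncomputable def fracSeminorm {k : ℕ} {F : Type*} [NormedAddCommGroup F]
    (G : Set (EuclideanSpace ℝ (Fin k))) (δ : ℝ) (ℓ : ℝ≥0∞)
    (u : EuclideanSpace ℝ (Fin k) → F) : ℝ≥0∞ :=
  if ℓ = ∞ then
    ⨆ x ∈ G, ⨆ y ∈ G, ⨆ _ : x ≠ y, ‖u y - u x‖ₑ / ‖y - x‖ₑ ^ δ
  else
    (∫⁻ x in G, ∫⁻ y in G,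
      ‖u x - u y‖ₑ ^ ℓ.toReal / ‖x - y‖ₑ ^ (k + δ * ℓ.toReal)) ^ (1 / ℓ.toReal)

/-- The norm of `W^{δ,ℓ}(G, F)`, with values in `[0, ∞]`. -/
noncomputable def sobolevNorm {k : ℕ} {F : Type*} [NormedAddCommGroup F]
    (G : Set (EuclideanSpace ℝ (Fin k))) (δ : ℝ) (ℓ : ℝ≥0∞)
    (u : EuclideanSpace ℝ (Fin k) → F) : ℝ≥0∞ :=
  if ℓ = ∞ then
    (⨆ x ∈ G, ‖u x‖ₑ) + fracSeminorm G δ ℓ u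
  else
    ((∫⁻ x in G, ‖u x‖ₑ ^ ℓ.toReal) + fracSeminorm G δ ℓ u ^ ℓ.toReal) ^ (1 / ℓ.toReal)

/-- `u ∈ W^{δ,ℓ}(G, F)`. Only the values of `u` on `G` matter. -/
def MemSobolev {k : ℕ} {F : Type*} [NormedAddCommGroup F]
    (G : Set (EuclideanSpace ℝ (Fin k))) (δ : ℝ) (ℓ : ℝ≥0∞)
    (u : EuclideanSpace ℝ (Fin k) → F) : Prop :=
  AEStronglyMeasurable u (volume.restrict G) ∧ sobolevNorm G δ ℓ u < ∞

/-- The bound `[f]_{δ,ℓ} ≤ C` for the equivalence class (modulo null sets of `G`) of `f`: some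
representative of the class satisfies it. For finite `ℓ` this is the same for all representatives;
for `ℓ = ∞` it selects the continuous one. -/
def ClassSeminormLE {k : ℕ} {F : Type*} [NormedAddCommGroup F]
    (G : Set (EuclideanSpace ℝ (Fin k))) (δ : ℝ) (ℓ : ℝ≥0∞)
    (f : EuclideanSpace ℝ (Fin k) → F) (C : ℝ≥0∞) : Prop :=
  ∃ g : EuclideanSpace ℝ (Fin k) → F, g =ᵐ[volume.restrict G] f ∧ fracSeminorm G δ ℓ g ≤ C

/-- `l` is the approximate limit of `φ` at `x`. -/
def HasApproxLimit {n : ℕ} (φ : EuclideanSpace ℝ (Fin n) → ℝ) (x : EuclideanSpace ℝ (Fin n))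
    (l : ℝ) : Prop :=
  Tendsto (fun ρ : ℝ => ⨍ z in Metric.ball x ρ, |φ z - l|) (𝓝[>] 0) (𝓝 0)

/-- The approximate discontinuity set `S_φ`. -/
def approxDiscontinuitySet {n : ℕ} (φ : EuclideanSpace ℝ (Fin n) → ℝ) :
    Set (EuclideanSpace ℝ (Fin n)) :=
  {x | ¬ ∃ l, HasApproxLimit φ x l}

/-- `ψ` is a Lebesgue representative of `φ`: a Borel function which agrees with the approximate
limit of `φ` outside of `S_φ`. -/
def IsLebesgueRepresentative {n : ℕ} (φ ψ : EuclideanSpace ℝ (Fin n) → ℝ) : Prop :=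
  Measurable ψ ∧ ∀ x l, HasApproxLimit φ x l → ψ x = l

/-- The occupation measure `μ_u(B) = ℒᵏ({x ∈ G : u(x) ∈ B})`. -/
noncomputable def occupationMeasure {k n : ℕ} (G : Set (EuclideanSpace ℝ (Fin k)))
    (u : EuclideanSpace ℝ (Fin k) → EuclideanSpace ℝ (Fin n)) :
    Measure (EuclideanSpace ℝ (Fin n)) :=
  Measure.map u (volume.restrict G)

end NonlinearComposition

namespace NonlinearComposition

open scoped Convolution RealInnerProductSpace

/-! Write `U` for the Riesz potential `U^{1-s}‖Dφ‖`. Everything rests on the pointwise inequality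
`|ψ ξ - ψ η| ≤ C |ξ - η|^s (U ξ + U η)` for Lebesgue representatives `ψ`
(`exists_enorm_sub_le_rieszPotential`). By Poincaré, the integral of `|φ - mean|` over `B(ξ, ρ)` is
at most a constant times `ρ ‖Dφ‖(B(ξ, 4ρ))`. The kernel of `U` is at least `(4ρ)^(1-s-n)` on that
ball, so the mean oscillation is at most a constant times `ρ^s U ξ`. These bounds sum geometrically
over dyadic radii: where `U ξ < ∞` the approximate limit exists and ball means converge to it at
rate `ρ^s`. Comparing the means over `B(η, ρ) ⊆ B(ξ, 2ρ)` with `ρ = |ξ - η|` links the two points.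
Finite energy makes `U (u x)` finite almost everywhere, so `u` avoids `S_φ` almost everywhere.

For finite `r`, insert `u` and apply Hölder on `G × G` with exponents `a = sr/q`, `b = r/p`, `c = 1
- a - b ≥ 0` (`lintegral_lintegral_weighted_le`). The first factor is the Gagliardo integral of `u`,
the second the energy weighted by `|x - y|^(ε - k)`, the third that kernel alone, where `ε = θs -
β`. For `ε > 0` the kernel is integrable, with a bound depending on the diameter. For `ε = 0` it is
not, but `q = sr` gives `a = 1` and `b = c = 0`, so neither the kernel nor the domain enters.

For `r = ∞` necessarily `p = q = ∞`; then `u` is Hölder continuous, and lower semicontinuity of `U`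
turns the essential bound on `U ∘ u` into one at every point of `G`. -/

/-! ### Mollification and the Poincaré inequality -/

lemma IsBV.isGradientMeasure {n : ℕ} {φ : EuclideanSpace ℝ (Fin n) → ℝ} (hφ : IsBV φ) :
    IsGradientMeasure φ (gradientMeasure φ) := by
  rw [gradientMeasure, dif_pos hφ.2]
  exact hφ.2.choose_spec

/-- The gradient of a mollification is the mollification of the gradient measure. -/
lemma fderiv_mollification {n : ℕ} {φ : EuclideanSpace ℝ (Fin n) → ℝ}
    {D : VectorMeasure (EuclideanSpace ℝ (Fin n)) (EuclideanSpace ℝ (Fin n))}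
    (hφ : Integrable φ) (hD : IsGradientMeasure φ D)
    {f : EuclideanSpace ℝ (Fin n) → ℝ} (hf : ContDiff ℝ (⊤ : ℕ∞) f) (hfc : HasCompactSupport f)
    (x v : EuclideanSpace ℝ (Fin n)) :
    fderiv ℝ (f ⋆[ContinuousLinearMap.lsmul ℝ ℝ, volume] φ) x v =
      ⟪D.integral (fun y => f (x - y)) (ContinuousLinearMap.lsmul ℝ ℝ), v⟫ := by
  have hf1 : ContDiff ℝ 1 f := hf.of_le (by exact_mod_cast le_top)
  have hd := (hfc.hasFDerivAt_convolution_left (ContinuousLinearMap.lsmul ℝ ℝ) hf1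
    hφ.locallyIntegrable x).fderiv
  rw [hd]
  set w := D.integral (fun y => f (x - y)) (ContinuousLinearMap.lsmul ℝ ℝ) with hw
  set T := (fderiv ℝ f ⋆[(ContinuousLinearMap.lsmul ℝ ℝ).precompL _, volume] φ) x with hT
  suffices h : (T : EuclideanSpace ℝ (Fin n) →ₗ[ℝ] ℝ) = (innerSL ℝ w : _ →L[ℝ] ℝ) by
    have := LinearMap.congr_fun h v
    simpa using this
  refine (EuclideanSpace.basisFun (Fin n) ℝ).toBasis.ext fun i => ?_
  have hconv := (hfc.fderiv ℝ).convolutionExists_left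
    ((ContinuousLinearMap.lsmul ℝ ℝ).precompL (EuclideanSpace ℝ (Fin n)))
    (hf1.continuous_fderiv one_ne_zero) (hφ.locallyIntegrable (μ := volume)) x
  -- The test function is the reflected translate of `f`; the sign from its chain rule cancels the
  -- sign of the integration by parts.
  have key := hD.integral_eq (fun y => f (x - y)) (hf.comp (contDiff_const.sub contDiff_id))
    (hfc.comp_homeomorph (Homeomorph.subLeft x)) i
  have hder : ∀ y, fderiv ℝ (fun y => f (x - y)) y = - fderiv ℝ f (x - y) := by
    intro y
    have h1 : HasFDerivAt (fun y => f (x - y))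
        ((fderiv ℝ f (x - y)).comp (-ContinuousLinearMap.id ℝ (EuclideanSpace ℝ (Fin n)))) y :=
      ((hf1.differentiable one_ne_zero) (x - y)).hasFDerivAt.comp y
        ((hasFDerivAt_id y).const_sub x)
    rw [h1.fderiv]
    ext v; simp
  simp only [OrthonormalBasis.coe_toBasis, EuclideanSpace.basisFun_apply,
    ContinuousLinearMap.coe_coe, innerSL_apply_apply]
  rw [real_inner_comm, EuclideanSpace.inner_single_left, hT, convolution_def,
    ContinuousLinearMap.integral_apply hconv]
  simp only [hder, _root_.neg_apply, mul_neg, integral_neg, neg_inj] at key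
  rw [map_one, one_mul, hw, ← key, ← integral_sub_left_eq_self _ volume x]
  simp [ContinuousLinearMap.precompL_apply, mul_comm]

lemma enorm_fderiv_mollification_le {n : ℕ} {φ : EuclideanSpace ℝ (Fin n) → ℝ}
    {D : VectorMeasure (EuclideanSpace ℝ (Fin n)) (EuclideanSpace ℝ (Fin n))}
    (hφ : Integrable φ) (hD : IsGradientMeasure φ D)
    {f : EuclideanSpace ℝ (Fin n) → ℝ} (hf : ContDiff ℝ (⊤ : ℕ∞) f) (hfc : HasCompactSupport f)
    (x v : EuclideanSpace ℝ (Fin n)) :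
    ‖fderiv ℝ (f ⋆[ContinuousLinearMap.lsmul ℝ ℝ, volume] φ) x v‖ₑ ≤
      (∫⁻ y, ‖f (x - y)‖ₑ ∂D.variation) * ‖v‖ₑ := by
  rw [fderiv_mollification hφ hD hf hfc]
  have h1 := D.enorm_integral_le_lintegral_enorm (f := fun y => f (x - y))
    (B := ContinuousLinearMap.lsmul ℝ ℝ)
  have h2 : ‖(ContinuousLinearMap.lsmul ℝ ℝ : ℝ →L[ℝ] EuclideanSpace ℝ (Fin n) →L[ℝ] _)‖ₑ ≤ 1 :=
    ContinuousLinearMap.opENorm_lsmul_le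
  have h3 : ‖⟪D.integral (fun y => f (x - y)) (ContinuousLinearMap.lsmul ℝ ℝ), v⟫‖ₑ ≤
      ‖D.integral (fun y => f (x - y)) (ContinuousLinearMap.lsmul ℝ ℝ)‖ₑ * ‖v‖ₑ := by
    simp only [enorm_eq_nnnorm]
    exact_mod_cast nnnorm_inner_le_nnnorm _ _
  grw [h3, h1, h2, one_mul]

/-- Translation estimate for the mollification of a function with a gradient measure. -/
lemma enorm_mollification_sub_le {n : ℕ} {φ : EuclideanSpace ℝ (Fin n) → ℝ}
    {D : VectorMeasure (EuclideanSpace ℝ (Fin n)) (EuclideanSpace ℝ (Fin n))}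
    (hφ : Integrable φ) (hD : IsGradientMeasure φ D)
    {f : EuclideanSpace ℝ (Fin n) → ℝ} (hf : ContDiff ℝ (⊤ : ℕ∞) f) (hfc : HasCompactSupport f)
    (x h : EuclideanSpace ℝ (Fin n)) :
    ‖(f ⋆[ContinuousLinearMap.lsmul ℝ ℝ, volume] φ) (x + h) -
      (f ⋆[ContinuousLinearMap.lsmul ℝ ℝ, volume] φ) x‖ₑ ≤
      (∫⁻ t in Icc (0 : ℝ) 1, ∫⁻ y, ‖f (x + t • h - y)‖ₑ ∂D.variation) * ‖h‖ₑ := by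
  set F := f ⋆[ContinuousLinearMap.lsmul ℝ ℝ, volume] φ with hF
  have hFc : ContDiff ℝ 1 F := hfc.contDiff_convolution_left _
    (hf.of_le (by exact_mod_cast le_top)) hφ.locallyIntegrable
  have hγ : ∀ t : ℝ, HasDerivAt (fun t : ℝ => F (x + t • h)) (fderiv ℝ F (x + t • h) h) t := by
    intro t
    have h1 : HasDerivAt (fun t : ℝ => x + t • h) h t := by
      simpa using ((hasDerivAt_id t).smul_const h).const_add x
    exact ((hFc.differentiable one_ne_zero) _).hasFDerivAt.comp_hasDerivAt t h1
  have h2 : ContDiff ℝ 1 (fun t : ℝ => F (x + t • h)) := by fun_prop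
  have h3 := enorm_sub_le_lintegral_deriv_of_contDiffOn_Icc h2.contDiffOn zero_le_one
  simp only [one_smul, zero_smul, add_zero] at h3
  refine h3.trans ?_
  have : ∀ t, deriv (fun t : ℝ => F (x + t • h)) t = fderiv ℝ F (x + t • h) h :=
    fun t => (hγ t).deriv
  simp only [this]
  rw [← lintegral_mul_const' _ _ enorm_ne_top]
  exact lintegral_mono fun t => enorm_fderiv_mollification_le hφ hD hf hfc _ _

/-- The mass on a ball of a mollified measure is at most the mass of a slightly larger ball. -/
lemma setLIntegral_ball_mollifier_le {n : ℕ} {μ : Measure (EuclideanSpace ℝ (Fin n))}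
    [IsFiniteMeasure μ]
    (f : ContDiffBump (0 : EuclideanSpace ℝ (Fin n))) (ξ z : EuclideanSpace ℝ (Fin n))
    {ρ r : ℝ} (hr : ρ + ‖z‖ + f.rOut ≤ r) :
    ∫⁻ x in Metric.ball ξ ρ, ∫⁻ y, ‖f.normed volume (x + z - y)‖ₑ ∂μ ≤
      μ (Metric.closedBall ξ r) := by
  have hc : Continuous (f.normed volume) := (f.contDiff_normed (n := 0)).continuous
  have h1 : ∀ w : EuclideanSpace ℝ (Fin n), ∫⁻ x, ‖f.normed volume (x + w)‖ₑ = 1 := by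
    intro w
    rw [lintegral_add_right_eq_self (fun x => ‖f.normed volume x‖ₑ),
      ← ofReal_integral_norm_eq_lintegral_enorm f.integrable_normed]
    simp [abs_of_nonneg (f.nonneg_normed _), f.integral_normed]
  -- After Tonelli, the inner integral over `x` is at most the total mass 1 of the bump, and it
  -- vanishes unless `y` lies in the larger ball.
  rw [lintegral_lintegral_swap (by fun_prop), ← setLIntegral_one,
    ← lintegral_indicator Metric.isClosed_closedBall.measurableSet]
  refine lintegral_mono fun y => ?_
  by_cases hy : y ∈ Metric.closedBall ξ r
  · rw [indicator_of_mem hy, ← h1 (z - y)]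
    simp only [add_sub_assoc]
    exact setLIntegral_le_lintegral _ _
  · rw [indicator_of_notMem hy, nonpos_iff_eq_zero]
    refine setLIntegral_eq_zero Metric.isOpen_ball.measurableSet fun x hx => ?_
    rw [Pi.zero_apply, enorm_eq_zero]
    by_contra hne
    have hmem : x + z - y ∈ Function.support (f.normed volume) := hne
    rw [f.support_normed_eq, mem_ball_zero_iff] at hmem
    apply hy
    rw [Metric.mem_closedBall, dist_eq_norm]
    rw [Metric.mem_ball, dist_eq_norm] at hx
    have : y - ξ = (x - ξ) + z - (x + z - y) := by abel
    rw [this]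
    linarith [norm_sub_le ((x - ξ) + z) (x + z - y), norm_add_le (x - ξ) z]

/-- The derivative is integrated along the segment from `x` to `x + h`. Each intermediate translate
`t • h` is no longer than `h`, so every `t` contributes at most the mass of the same enlarged ball.
-/
lemma setLIntegral_mollification_translate_sub_le {n : ℕ} {φ : EuclideanSpace ℝ (Fin n) → ℝ}
    {D : VectorMeasure (EuclideanSpace ℝ (Fin n)) (EuclideanSpace ℝ (Fin n))}
    (hφ : Integrable φ) (hD : IsGradientMeasure φ D)
    (f : ContDiffBump (0 : EuclideanSpace ℝ (Fin n))) (ξ h : EuclideanSpace ℝ (Fin n))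
    {ρ r : ℝ} (hr : ρ + ‖h‖ + f.rOut ≤ r) :
    ∫⁻ x in Metric.ball ξ ρ,
      ‖(f.normed volume ⋆[ContinuousLinearMap.lsmul ℝ ℝ, volume] φ) (x + h) -
        (f.normed volume ⋆[ContinuousLinearMap.lsmul ℝ ℝ, volume] φ) x‖ₑ ≤
      D.variation (Metric.closedBall ξ r) * ‖h‖ₑ := by
  have : IsFiniteMeasure D.variation := ⟨hD.finite_variation⟩
  have hc : Continuous (f.normed volume) := (f.contDiff_normed (n := 0)).continuous
  refine (lintegral_mono fun x => enorm_mollification_sub_le hφ hD f.contDiff_normed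
    f.hasCompactSupport_normed x h).trans ?_
  rw [lintegral_mul_const' _ _ enorm_ne_top]
  gcongr
  rw [lintegral_lintegral_swap]
  · calc _ ≤ ∫⁻ t in Icc (0 : ℝ) 1, D.variation (Metric.closedBall ξ r) := by
          refine setLIntegral_mono measurable_const fun t ht => ?_
          refine setLIntegral_ball_mollifier_le f ξ (t • h) ?_
          have : ‖t • h‖ ≤ ‖h‖ := by
            rw [norm_smul, Real.norm_of_nonneg ht.1]
            exact mul_le_of_le_one_left (norm_nonneg _) ht.2
          linarith
      _ = D.variation (Metric.closedBall ξ r) := by simp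
  · refine Measurable.aemeasurable ?_
    exact Measurable.lintegral_prod_right'
      (f := fun q : (EuclideanSpace ℝ (Fin n) × ℝ) × EuclideanSpace ℝ (Fin n) =>
        ‖f.normed volume (q.1.1 + q.1.2 • h - q.2)‖ₑ)
      (Continuous.measurable (by fun_prop))

/-- The Poincaré inequality for functions with a gradient measure. -/
lemma lintegral_lintegral_enorm_sub_le {n : ℕ} {φ : EuclideanSpace ℝ (Fin n) → ℝ}
    {D : VectorMeasure (EuclideanSpace ℝ (Fin n)) (EuclideanSpace ℝ (Fin n))}
    (hφ : Integrable φ) (hD : IsGradientMeasure φ D) (ξ : EuclideanSpace ℝ (Fin n))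
    {ρ : ℝ} (hρ : 0 < ρ) :
    ∫⁻ x in Metric.ball ξ ρ, ∫⁻ y in Metric.ball ξ ρ, ‖φ y - φ x‖ₑ ≤
      volume (Metric.ball (0 : EuclideanSpace ℝ (Fin n)) (2 * ρ)) * ENNReal.ofReal (2 * ρ) *
        D.variation (Metric.closedBall ξ (4 * ρ)) := by
  have hpos : ∀ i : ℕ, 0 < ρ / (i + 1) := fun i => by positivity
  -- The outer radius never exceeds `ρ`, so `ρ + 2ρ + ρ = 4ρ` accounts for the ball, the translation
  -- and the mollifier. The fixed ratio 2 of the radii is what almost everywhere convergence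
  -- requires.
  let f : ℕ → ContDiffBump (0 : EuclideanSpace ℝ (Fin n)) := fun i =>
    ⟨ρ / (i + 1) / 2, ρ / (i + 1), half_pos (hpos i), half_lt_self (hpos i)⟩
  let F : ℕ → EuclideanSpace ℝ (Fin n) → ℝ := fun i =>
    (f i).normed volume ⋆[ContinuousLinearMap.lsmul ℝ ℝ, volume] φ
  have hFc : ∀ i, Continuous (F i) := fun i =>
    ((f i).hasCompactSupport_normed.contDiff_convolution_left _
      ((f i).contDiff_normed (n := 0)) hφ.locallyIntegrable).continuous
  have hlim : ∀ᵐ x, Tendsto (fun i => F i x) atTop (𝓝 (φ x)) := by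
    refine ContDiffBump.ae_convolution_tendsto_right_of_locallyIntegrable (K := 2) ?_ ?_
      hφ.locallyIntegrable
    · exact tendsto_const_div_atTop_nhds_zero_nat ρ |>.comp (tendsto_add_atTop_nat 1) |>.congr
        fun i => by simp [f]
    · exact Eventually.of_forall fun i => by simp only [f]; linarith
  set B := Metric.ball ξ ρ with hB
  have hBm : MeasurableSet B := Metric.isOpen_ball.measurableSet
  have hbound : ∀ i, ∫⁻ x in B, ∫⁻ y in B, ‖F i y - F i x‖ₑ ≤
      volume (Metric.ball (0 : EuclideanSpace ℝ (Fin n)) (2 * ρ)) * ENNReal.ofReal (2 * ρ) *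
        D.variation (Metric.closedBall ξ (4 * ρ)) := by
    intro i
    have hFi := hFc i
    calc ∫⁻ x in B, ∫⁻ y in B, ‖F i y - F i x‖ₑ
        ≤ ∫⁻ x in B, ∫⁻ h in Metric.ball 0 (2 * ρ), ‖F i (x + h) - F i x‖ₑ := by
          refine setLIntegral_mono' hBm fun x hx => ?_
          rw [← lintegral_indicator hBm, ← lintegral_indicator Metric.isOpen_ball.measurableSet,
            ← lintegral_add_left_eq_self _ x]
          refine lintegral_mono fun h => ?_
          by_cases hxh : x + h ∈ B
          · have hh : h ∈ Metric.ball (0 : EuclideanSpace ℝ (Fin n)) (2 * ρ) := by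
              rw [hB, Metric.mem_ball, dist_eq_norm] at hx hxh
              rw [mem_ball_zero_iff]
              have : h = (x + h - ξ) - (x - ξ) := by abel
              linarith [norm_sub_le (x + h - ξ) (x - ξ), congrArg norm this]
            rw [indicator_of_mem hxh, indicator_of_mem hh]
          · rw [indicator_of_notMem hxh]
            exact zero_le
      _ = ∫⁻ h in Metric.ball 0 (2 * ρ), ∫⁻ x in B, ‖F i (x + h) - F i x‖ₑ :=
          lintegral_lintegral_swap (by fun_prop)
      _ ≤ ∫⁻ h in Metric.ball (0 : EuclideanSpace ℝ (Fin n)) (2 * ρ),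
            D.variation (Metric.closedBall ξ (4 * ρ)) * ENNReal.ofReal (2 * ρ) := by
          refine setLIntegral_mono measurable_const fun h hh => ?_
          rw [mem_ball_zero_iff] at hh
          have hle : ρ / (i + 1) ≤ ρ := div_le_self hρ.le (by simp)
          refine (setLIntegral_mollification_translate_sub_le hφ hD (f i) ξ h (r := 4 * ρ)
            ?_).trans ?_
          · simp only [f]; linarith
          · gcongr
            rw [← ofReal_norm]
            exact ENNReal.ofReal_le_ofReal hh.le
      _ = _ := by rw [setLIntegral_const]; ring
  have hlim' := ae_restrict_of_ae (s := B) hlim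
  -- Fatou's lemma in each variable: almost everywhere convergence of the mollifications suffices.
  calc ∫⁻ x in B, ∫⁻ y in B, ‖φ y - φ x‖ₑ
      ≤ ∫⁻ x in B, liminf (fun i => ∫⁻ y in B, ‖F i y - F i x‖ₑ) atTop := by
        refine lintegral_mono_ae (hlim'.mono fun x hx => ?_)
        calc _ ≤ ∫⁻ y in B, liminf (fun i => ‖F i y - F i x‖ₑ) atTop := by
              refine lintegral_mono_ae (hlim'.mono fun y hy => ?_)
              exact ((hy.sub hx).enorm.liminf_eq).ge
          _ ≤ _ := lintegral_liminf_le fun i => by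
              have := hFc i
              fun_prop
    _ ≤ liminf (fun i => ∫⁻ x in B, ∫⁻ y in B, ‖F i y - F i x‖ₑ) atTop := by
        refine lintegral_liminf_le fun i => ?_
        have := hFc i
        exact Measurable.lintegral_prod_right'
          (f := fun q : EuclideanSpace ℝ (Fin n) × EuclideanSpace ℝ (Fin n) =>
            ‖F i q.2 - F i q.1‖ₑ) (by fun_prop)
    _ ≤ _ := by
        refine (liminf_le_liminf (Eventually.of_forall hbound)).trans ?_
        simp

/-! ### Oscillation, approximate limits and the pointwise estimate -/

/-- The exponent `1 - s - n` is negative, so the kernel is at least `t ^ (1 - s - n)` throughout the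
ball, including its centre, where it is infinite. -/
lemma measure_closedBall_le_rieszPotential {n : ℕ} (hn : 0 < n) {s : ℝ} (hs : 0 < s)
    (μ : Measure (EuclideanSpace ℝ (Fin n))) (ξ : EuclideanSpace ℝ (Fin n)) {t : ℝ} (ht : 0 < t) :
    μ (Metric.closedBall ξ t) ≤ ENNReal.ofReal (t ^ (n - 1 + s)) * rieszPotential (1 - s) μ ξ := by
  have hn1 : (1 : ℝ) ≤ n := by exact_mod_cast hn
  have h1 : ENNReal.ofReal (t ^ (1 - s - n)) * μ (Metric.closedBall ξ t) ≤
      rieszPotential (1 - s) μ ξ := by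
    rw [rieszPotential, ← setLIntegral_const]
    refine (setLIntegral_mono' Metric.isClosed_closedBall.measurableSet fun y hy => ?_).trans
      (setLIntegral_le_lintegral _ _)
    rw [← ENNReal.ofReal_rpow_of_pos ht]
    have hle : ‖ξ - y‖ₑ ≤ ENNReal.ofReal t := by
      rw [← ofReal_norm, ← dist_eq_norm, dist_comm]
      exact ENNReal.ofReal_le_ofReal hy
    rw [show 1 - s - n = -(n + s - 1 : ℝ) by ring, ENNReal.rpow_neg, ENNReal.rpow_neg]
    exact ENNReal.inv_le_inv.2 (ENNReal.rpow_le_rpow hle (by linarith))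
  calc μ (Metric.closedBall ξ t)
      = ENNReal.ofReal (t ^ (n - 1 + s)) *
          (ENNReal.ofReal (t ^ (1 - s - n)) * μ (Metric.closedBall ξ t)) := by
        rw [← mul_assoc, ← ENNReal.ofReal_mul (by positivity), ← Real.rpow_add ht]
        ring_nf
        simp
    _ ≤ _ := by gcongr

/-- Geometric convergence of a function of the radius whose variation over dyadic scales is
controlled by a power of the scale. -/
lemma exists_limit_of_dyadic_bound {a : ℝ → ℝ} {s C : ℝ} (hs : 0 < s) (hC : 0 ≤ C)
    (h : ∀ ρ > 0, ∀ ρ', ρ / 2 ≤ ρ' → ρ' ≤ ρ → |a ρ' - a ρ| ≤ C * ρ ^ s) :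
    ∃ l, ∀ ρ > 0, |a ρ - l| ≤ C / (1 - 2 ^ (-s)) * ρ ^ s := by
  have h2 : (2 : ℝ) ^ (-s) < 1 := Real.rpow_lt_one_of_one_lt_of_neg one_lt_two (by linarith)
  have h20 : (0 : ℝ) < 2 ^ (-s) := by positivity
  -- `K` is the fixed point of `K ↦ K * 2 ^ (-s) + C`, so the induction over the number of halvings
  -- reproduces the same constant.
  set K := C / (1 - 2 ^ (-s)) with hK
  have hK0 : 0 ≤ K := div_nonneg hC (by linarith)
  have hKC : K * 2 ^ (-s) + C = K := by
    have : K * (1 - 2 ^ (-s)) = C := div_mul_cancel₀ _ (by linarith)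
    linarith
  have hind : ∀ j : ℕ, ∀ ρ > 0, ∀ ρ', ρ / 2 ^ j ≤ ρ' → ρ' ≤ ρ → |a ρ' - a ρ| ≤ K * ρ ^ s := by
    intro j
    induction j with
    | zero =>
      intro ρ hρ ρ' h1 h2
      have : ρ' = ρ := le_antisymm h2 (by simpa using h1)
      rw [this, sub_self, abs_zero]
      positivity
    | succ j ih =>
      intro ρ hρ ρ' h1 h2
      have hρs : 0 < ρ ^ s := by positivity
      rcases le_or_gt (ρ / 2) ρ' with h3 | h3
      · refine (h ρ hρ ρ' h3 h2).trans ?_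
        have : 0 ≤ K * 2 ^ (-s) := by positivity
        gcongr
        linarith
      · have h4 := ih (ρ / 2) (half_pos hρ) ρ'
          (by rw [div_div, ← pow_succ']; exact h1) h3.le
        have h5 := h ρ hρ (ρ / 2) le_rfl (half_le_self hρ.le)
        have h6 : (ρ / 2) ^ s = 2 ^ (-s) * ρ ^ s := by
          rw [Real.div_rpow hρ.le zero_le_two, Real.rpow_neg zero_le_two]
          field_simp
        rw [h6] at h4
        calc |a ρ' - a ρ| ≤ |a ρ' - a (ρ / 2)| + |a (ρ / 2) - a ρ| := abs_sub_le _ _ _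
          _ ≤ K * (2 ^ (-s) * ρ ^ s) + C * ρ ^ s := add_le_add h4 h5
          _ = (K * 2 ^ (-s) + C) * ρ ^ s := by ring
          _ = K * ρ ^ s := by rw [hKC]
  have hall : ∀ ρ > 0, ∀ ρ' > 0, ρ' ≤ ρ → |a ρ' - a ρ| ≤ K * ρ ^ s := by
    intro ρ hρ ρ' hρ' hle
    obtain ⟨j, hj⟩ := pow_unbounded_of_one_lt (ρ / ρ') (one_lt_two : (1 : ℝ) < 2)
    refine hind j ρ hρ ρ' ?_ hle
    rw [div_le_iff₀ (by positivity)]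
    rw [div_lt_iff₀ hρ'] at hj
    linarith
  have hpow : Tendsto (fun ρ : ℝ => K * ρ ^ s) (𝓝[>] 0) (𝓝 0) := by
    have : Tendsto (fun ρ : ℝ => K * ρ ^ s) (𝓝 0) (𝓝 (K * 0 ^ s)) :=
      ((Real.continuous_rpow_const hs.le).tendsto 0).const_mul K
    rw [Real.zero_rpow hs.ne', mul_zero] at this
    exact this.mono_left nhdsWithin_le_nhds
  have hcauchy : Cauchy (map a (𝓝[>] 0)) := by
    rw [Metric.cauchy_iff]
    refine ⟨inferInstance, fun ε hε => ?_⟩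
    have hev : ∀ᶠ ρ in 𝓝[>] (0 : ℝ), K * ρ ^ s < ε := hpow.eventually (gt_mem_nhds hε)
    obtain ⟨ρ₀, hρ₀, hρ₀0⟩ := (hev.and self_mem_nhdsWithin).exists
    refine ⟨a '' Ioc 0 ρ₀, image_mem_map (Ioc_mem_nhdsGT hρ₀0), ?_⟩
    have key : ∀ x ∈ Ioc 0 ρ₀, ∀ y ∈ Ioc 0 ρ₀, x ≤ y → dist (a x) (a y) < ε := by
      intro x hx y hy hxy
      rw [Real.dist_eq]
      refine (hall y hy.1 x hx.1 hxy).trans_lt (lt_of_le_of_lt ?_ hρ₀)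
      have := hy.1
      gcongr
      exact hy.2
    rintro _ ⟨x, hx, rfl⟩ _ ⟨y, hy, rfl⟩
    rcases le_total x y with hxy | hxy
    · exact key x hx y hy hxy
    · rw [dist_comm]; exact key y hy x hx hxy
  obtain ⟨l, hl⟩ := CompleteSpace.complete hcauchy
  refine ⟨l, fun ρ hρ => ?_⟩
  have ht : Tendsto (fun ρ' => |a ρ - a ρ'|) (𝓝[>] 0) (𝓝 |a ρ - l|) :=
    (tendsto_const_nhds.sub hl).abs
  refine le_of_tendsto ht ?_
  filter_upwards [Ioc_mem_nhdsGT hρ] with ρ' hρ'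
  rw [abs_sub_comm]
  exact hall ρ hρ ρ' hρ'.1 hρ'.2

/-- Mean oscillation bound in terms of the Riesz potential of the gradient measure. -/
lemma setLIntegral_enorm_sub_average_le {n : ℕ} (hn : 0 < n) {s : ℝ} (hs : 0 < s)
    {φ : EuclideanSpace ℝ (Fin n) → ℝ} (hφ : IsBV φ) (ξ : EuclideanSpace ℝ (Fin n))
    {ρ : ℝ} (hρ : 0 < ρ) :
    ∫⁻ x in Metric.ball ξ ρ, ‖φ x - ⨍ y in Metric.ball ξ ρ, φ y‖ₑ ≤
      ENNReal.ofReal (2 ^ (n + 1) * 4 ^ (n - 1 + s) * ρ ^ (n + s)) *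
        rieszPotential (1 - s) (gradientMeasure φ).variation ξ := by
  set B := Metric.ball ξ ρ with hB
  set μ := (gradientMeasure φ).variation
  have hv0 : volume B ≠ 0 := (Metric.measure_ball_pos _ _ hρ).ne'
  have hvt : volume B ≠ ∞ := measure_ball_lt_top.ne
  have hpt : ∀ x, ‖φ x - ⨍ y in B, φ y‖ₑ ≤ (volume B)⁻¹ * ∫⁻ y in B, ‖φ y - φ x‖ₑ := by
    intro x
    have : Fact (volume B < ∞) := ⟨hvt.lt_top⟩
    have hne : NeZero (volume.restrict B) := ⟨by simpa [Measure.restrict_eq_zero] using hv0⟩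
    have h1 : φ x - ⨍ y in B, φ y = ⨍ y in B, (φ x - φ y) := by
      conv_lhs => rw [← average_const (volume.restrict B) (φ x)]
      simp only [average_eq, ← smul_sub]
      rw [integral_sub (integrable_const _) hφ.1.integrableOn]
    rw [h1, average_eq', Measure.restrict_apply_univ]
    refine (enorm_integral_le_lintegral_enorm _).trans ?_
    rw [lintegral_smul_measure, smul_eq_mul]
    simp only [enorm_sub_rev (φ x), le_refl]
  -- This volume comes from the Poincaré inequality; up to `2 ^ n` it cancels the normalisation of
  -- the mean.
  have hball : volume (Metric.ball (0 : EuclideanSpace ℝ (Fin n)) (2 * ρ)) =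
      2 ^ n * volume B := by
    rw [hB, Measure.addHaar_ball_mul_of_pos _ _ zero_lt_two, Measure.addHaar_ball_center _ ξ]
    congr 1
    rw [finrank_euclideanSpace_fin, ENNReal.ofReal_pow zero_le_two, ENNReal.ofReal_ofNat]
  calc ∫⁻ x in B, ‖φ x - ⨍ y in B, φ y‖ₑ
      ≤ ∫⁻ x in B, (volume B)⁻¹ * ∫⁻ y in B, ‖φ y - φ x‖ₑ := lintegral_mono fun x => hpt x
    _ = (volume B)⁻¹ * ∫⁻ x in B, ∫⁻ y in B, ‖φ y - φ x‖ₑ :=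
        lintegral_const_mul' _ _ (ENNReal.inv_ne_top.2 hv0)
    _ ≤ (volume B)⁻¹ * (2 ^ n * volume B * ENNReal.ofReal (2 * ρ) *
          (ENNReal.ofReal ((4 * ρ) ^ (n - 1 + s)) * rieszPotential (1 - s) μ ξ)) := by
        rw [← hball]
        gcongr
        refine (lintegral_lintegral_enorm_sub_le hφ.1 hφ.isGradientMeasure ξ hρ).trans ?_
        gcongr
        exact measure_closedBall_le_rieszPotential hn hs μ ξ (by positivity)
    _ = ((volume B)⁻¹ * volume B) * (2 ^ n * ENNReal.ofReal (2 * ρ) *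
          ENNReal.ofReal ((4 * ρ) ^ (n - 1 + s)) * rieszPotential (1 - s) μ ξ) := by ring
    _ = _ := by
        rw [ENNReal.inv_mul_cancel hv0 hvt, one_mul]
        congr 1
        rw [← ENNReal.ofReal_ofNat 2, ← ENNReal.ofReal_pow zero_le_two,
          ← ENNReal.ofReal_mul (by positivity), ← ENNReal.ofReal_mul (by positivity)]
        congr 1
        rw [Real.mul_rpow (by norm_num) hρ.le, show (n : ℝ) + s = (n - 1 + s) + 1 by ring,
          Real.rpow_add_one hρ.ne']
        ring

/-- Comparison of `φ` on a ball with its mean over a ball of comparable size. -/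
lemma average_abs_sub_average_le {n : ℕ} (hn : 0 < n) {s : ℝ} (hs : 0 < s)
    {φ : EuclideanSpace ℝ (Fin n) → ℝ} (hφ : IsBV φ) {ξ : EuclideanSpace ℝ (Fin n)}
    (hξ : rieszPotential (1 - s) (gradientMeasure φ).variation ξ < ∞)
    {η : EuclideanSpace ℝ (Fin n)}
    {ρ ρ' : ℝ} (hρ : 0 < ρ) (hρ' : ρ / 2 ≤ ρ') (hsub : Metric.ball η ρ' ⊆ Metric.ball ξ ρ) :
    ⨍ x in Metric.ball η ρ', |φ x - ⨍ y in Metric.ball ξ ρ, φ y| ≤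
      2 ^ (n + 1) * 4 ^ (n - 1 + s) * 2 ^ n /
        volume.real (Metric.ball (0 : EuclideanSpace ℝ (Fin n)) 1) *
        (rieszPotential (1 - s) (gradientMeasure φ).variation ξ).toReal * ρ ^ s := by
  set U := rieszPotential (1 - s) (gradientMeasure φ).variation ξ
  set m := ⨍ y in Metric.ball ξ ρ, φ y
  set ω := volume.real (Metric.ball (0 : EuclideanSpace ℝ (Fin n)) 1) with hω
  have hω0 : 0 < ω := ENNReal.toReal_pos (Metric.measure_ball_pos _ _ one_pos).ne'
    measure_ball_lt_top.ne
  have hρ'0 : 0 < ρ' := by linarith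
  have hvol : volume.real (Metric.ball η ρ') = ρ' ^ n * ω := by
    rw [measureReal_def, Measure.addHaar_ball_of_pos _ _ hρ'0, ENNReal.toReal_mul,
      finrank_euclideanSpace_fin, ENNReal.toReal_ofReal (by positivity), hω, measureReal_def]
  have hint : ∫ x in Metric.ball η ρ', |φ x - m| ≤
      2 ^ (n + 1) * 4 ^ (n - 1 + s) * ρ ^ (n + s) * U.toReal := by
    have h1 := setLIntegral_enorm_sub_average_le hn hs hφ ξ hρ
    have hfin : ENNReal.ofReal (2 ^ (n + 1) * 4 ^ (n - 1 + s) * ρ ^ (n + s)) * U ≠ ∞ :=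
      ENNReal.mul_ne_top ENNReal.ofReal_ne_top hξ.ne
    have h2 := ENNReal.toReal_mono hfin ((lintegral_mono_set hsub).trans h1)
    rw [ENNReal.toReal_mul, ENNReal.toReal_ofReal (by positivity)] at h2
    refine le_trans (le_of_eq ?_) h2
    have hmeas : AEStronglyMeasurable (fun x => φ x - m) (volume.restrict (Metric.ball η ρ')) :=
      hφ.1.1.restrict.sub aestronglyMeasurable_const
    exact integral_norm_eq_lintegral_enorm hmeas
  rw [setAverage_eq, hvol, smul_eq_mul]
  -- Averaging over the smaller ball costs a factor `2 ^ n` and turns `ρ ^ (n + s)` into `ρ ^ s`.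
  have hpow : (ρ / 2) ^ n ≤ ρ' ^ n := by gcongr
  have hT : 0 ≤ U.toReal := ENNReal.toReal_nonneg
  calc (ρ' ^ n * ω)⁻¹ * ∫ x in Metric.ball η ρ', |φ x - m|
      ≤ ((ρ / 2) ^ n * ω)⁻¹ * (2 ^ (n + 1) * 4 ^ (n - 1 + s) * ρ ^ (n + s) * U.toReal) := by
        gcongr
    _ = _ := by
        rw [Real.rpow_add hρ, Real.rpow_natCast, div_pow]
        field_simp

/-- The triangle inequality for the mean of `φ - c`; with `c` a mean over another ball, it bounds
differences of means by mean oscillations. -/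
lemma abs_average_sub_le {n : ℕ} {φ : EuclideanSpace ℝ (Fin n) → ℝ} (hφ : Integrable φ)
    (x : EuclideanSpace ℝ (Fin n)) {r : ℝ} (hr : 0 < r) (c : ℝ) :
    |(⨍ y in Metric.ball x r, φ y) - c| ≤ ⨍ y in Metric.ball x r, |φ y - c| := by
  have : Fact (volume (Metric.ball x r) < ∞) := ⟨measure_ball_lt_top⟩
  have hne : NeZero (volume.restrict (Metric.ball x r)) :=
    ⟨by simpa [Measure.restrict_eq_zero] using (Metric.measure_ball_pos volume x hr).ne'⟩
  have h1 : (⨍ y in Metric.ball x r, φ y) - c = ⨍ y in Metric.ball x r, (φ y - c) := by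
    conv_lhs => rw [← average_const (volume.restrict (Metric.ball x r)) c]
    simp only [average_eq, ← smul_sub]
    rw [integral_sub hφ.integrableOn (integrable_const _)]
  rw [h1]
  simp only [average_eq']
  exact abs_integral_le_integral_abs

/-- Where the Riesz potential of the gradient measure is finite, a function of bounded variation
has an approximate limit, and the ball means converge to it at rate `ρ ^ s`. -/
lemma exists_hasApproxLimit {n : ℕ} (hn : 0 < n) {s : ℝ} (hs : 0 < s)
    {φ : EuclideanSpace ℝ (Fin n) → ℝ} (hφ : IsBV φ) {ξ : EuclideanSpace ℝ (Fin n)}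
    (hξ : rieszPotential (1 - s) (gradientMeasure φ).variation ξ < ∞) :
    ∃ l, HasApproxLimit φ ξ l ∧ ∀ ρ > 0, |(⨍ y in Metric.ball ξ ρ, φ y) - l| ≤
      2 ^ (n + 1) * 4 ^ (n - 1 + s) * 2 ^ n /
        volume.real (Metric.ball (0 : EuclideanSpace ℝ (Fin n)) 1) *
        (rieszPotential (1 - s) (gradientMeasure φ).variation ξ).toReal / (1 - 2 ^ (-s)) *
        ρ ^ s := by
  set C := 2 ^ (n + 1) * 4 ^ (n - 1 + s) * 2 ^ n /
    volume.real (Metric.ball (0 : EuclideanSpace ℝ (Fin n)) 1) *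
    (rieszPotential (1 - s) (gradientMeasure φ).variation ξ).toReal with hC
  have hC0 : 0 ≤ C := by positivity
  obtain ⟨l, hl⟩ := exists_limit_of_dyadic_bound (a := fun ρ => ⨍ y in Metric.ball ξ ρ, φ y)
    hs hC0 fun ρ hρ ρ' h1 h2 => (abs_average_sub_le hφ.1 ξ (by linarith) _).trans
      (average_abs_sub_average_le hn hs hφ hξ hρ h1 (Metric.ball_subset_ball h2))
  refine ⟨l, ?_, hl⟩
  have hpow : Tendsto (fun ρ : ℝ => (C + C / (1 - 2 ^ (-s))) * ρ ^ s) (𝓝[>] 0) (𝓝 0) := by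
    have : Tendsto (fun ρ : ℝ => (C + C / (1 - 2 ^ (-s))) * ρ ^ s) (𝓝 0)
        (𝓝 ((C + C / (1 - 2 ^ (-s))) * 0 ^ s)) :=
      ((Real.continuous_rpow_const hs.le).tendsto 0).const_mul _
    rw [Real.zero_rpow hs.ne', mul_zero] at this
    exact this.mono_left nhdsWithin_le_nhds
  refine tendsto_of_tendsto_of_tendsto_of_le_of_le' tendsto_const_nhds hpow
    (Eventually.of_forall fun ρ => ?_) ?_
  · simp only [average_eq']
    exact integral_nonneg fun _ => abs_nonneg _
  · filter_upwards [self_mem_nhdsWithin] with ρ hρ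
    have hρ0 : 0 < ρ := hρ
    set m := ⨍ y in Metric.ball ξ ρ, φ y
    have hm : |m - l| ≤ C / (1 - 2 ^ (-s)) * ρ ^ s := hl ρ hρ0
    have hosc : ⨍ x in Metric.ball ξ ρ, |φ x - m| ≤ C * ρ ^ s :=
      average_abs_sub_average_le hn hs hφ hξ hρ0 (by linarith) subset_rfl
    have : Fact (volume (Metric.ball ξ ρ) < ∞) := ⟨measure_ball_lt_top⟩
    have hne : NeZero (volume.restrict (Metric.ball ξ ρ)) :=
      ⟨by simpa [Measure.restrict_eq_zero] using (Metric.measure_ball_pos volume ξ hρ0).ne'⟩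
    have hi : ∀ c : ℝ, IntegrableOn (fun z => |φ z - c|) (Metric.ball ξ ρ) := fun c =>
      (hφ.1.integrableOn.sub (integrable_const c)).abs
    -- The oscillation about the limit is at most that about the mean plus the distance from mean to
    -- limit, both of order `ρ ^ s`.
    calc ⨍ z in Metric.ball ξ ρ, |φ z - l|
        ≤ ⨍ z in Metric.ball ξ ρ, (|φ z - m| + |m - l|) := by
          rw [setAverage_eq, setAverage_eq]
          refine smul_le_smul_of_nonneg_left ?_ (by positivity)
          exact integral_mono (hi l) ((hi m).add (integrable_const _)) fun z => abs_sub_le _ _ _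
      _ = (⨍ z in Metric.ball ξ ρ, |φ z - m|) + |m - l| := by
          conv_rhs => rw [← average_const (volume.restrict (Metric.ball ξ ρ)) |m - l|]
          simp only [average_eq, ← smul_add]
          rw [integral_add (hi m) (integrable_const _)]
      _ ≤ _ := by rw [add_mul]; exact add_le_add hosc hm

/-- The pointwise estimate for functions of bounded variation. -/
theorem exists_enorm_sub_le_rieszPotential {n : ℕ} (hn : 0 < n) {s : ℝ} (hs : 0 < s) :
    ∃ C : ℝ≥0, 0 < C ∧ ∀ φ : EuclideanSpace ℝ (Fin n) → ℝ, IsBV φ →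
      ∀ ψ, IsLebesgueRepresentative φ ψ → ∀ ξ η,
        ‖ψ ξ - ψ η‖ₑ ≤ C * ‖ξ - η‖ₑ ^ s *
          (rieszPotential (1 - s) (gradientMeasure φ).variation ξ +
            rieszPotential (1 - s) (gradientMeasure φ).variation η) := by
  set A : ℝ := 2 ^ (n + 1) * 4 ^ (n - 1 + s) * 2 ^ n /
    volume.real (Metric.ball (0 : EuclideanSpace ℝ (Fin n)) 1) with hA
  have hA0 : 0 ≤ A := by positivity
  have h2 : (2 : ℝ) ^ (-s) < 1 := Real.rpow_lt_one_of_one_lt_of_neg one_lt_two (by linarith)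
  have hq : 0 < 1 - (2 : ℝ) ^ (-s) := by linarith
  have h2s : (1 : ℝ) ≤ 2 ^ s := Real.one_le_rpow one_le_two hs.le
  set K : ℝ := A / (1 - 2 ^ (-s)) with hK
  have hK0 : 0 ≤ K := by positivity
  -- At `ξ` the radius is `2ρ`: convergence of means costs `K * 2 ^ s` and the passage between the
  -- two balls `A * 2 ^ s`. At `η` only `K` is needed. The summand 1 makes `C` positive.
  set C : ℝ := (K + A) * 2 ^ s + 1 with hC
  have hC0 : 0 < C := by positivity
  refine ⟨C.toNNReal, Real.toNNReal_pos.2 hC0, fun φ hφ ψ hψ ξ η => ?_⟩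
  set U := rieszPotential (1 - s) (gradientMeasure φ).variation
  rcases eq_or_ne ξ η with rfl | hne
  · simp
  have hd : 0 < ‖ξ - η‖ := norm_pos_iff.2 (sub_ne_zero.2 hne)
  have hcoef : ((C.toNNReal : ℝ≥0∞) * ‖ξ - η‖ₑ ^ s) ≠ 0 := by
    refine mul_ne_zero ?_ ?_
    · exact ENNReal.coe_ne_zero.2 (Real.toNNReal_pos.2 hC0).ne'
    · rw [← ofReal_norm, ENNReal.ofReal_rpow_of_pos hd]
      exact (ENNReal.ofReal_pos.2 (by positivity)).ne'
  -- If a potential is infinite, so is the right-hand side, its coefficient being nonzero. Hence the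
  -- values of `ψ` on `S_φ` are irrelevant.
  by_cases hfin : U ξ < ∞ ∧ U η < ∞
  swap
  · have : U ξ + U η = ∞ := by
      rw [ENNReal.add_eq_top]
      by_contra hcon
      push Not at hcon
      exact hfin ⟨hcon.1.lt_top, hcon.2.lt_top⟩
    rw [this, ENNReal.mul_top hcoef]
    exact le_top
  obtain ⟨hξ, hη⟩ := hfin
  obtain ⟨l, hl, hlb⟩ := exists_hasApproxLimit hn hs hφ hξ
  obtain ⟨l', hl', hlb'⟩ := exists_hasApproxLimit hn hs hφ hη
  rw [hψ.2 ξ l hl, hψ.2 η l' hl']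
  set ρ := ‖ξ - η‖ with hρ
  have hsub : Metric.ball η ρ ⊆ Metric.ball ξ (2 * ρ) := by
    refine Metric.ball_subset_ball' ?_
    rw [dist_comm, dist_eq_norm, ← hρ]
    linarith
  have h3 : |(⨍ y in Metric.ball η ρ, φ y) - ⨍ y in Metric.ball ξ (2 * ρ), φ y| ≤
      A * (U ξ).toReal * (2 * ρ) ^ s := (abs_average_sub_le hφ.1 η hd _).trans
    (average_abs_sub_average_le hn hs hφ hξ (by positivity) (by linarith) hsub)
  have h4 := hlb (2 * ρ) (by positivity)
  have h5 := hlb' ρ hd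
  have hreal : |l - l'| ≤ C * ρ ^ s * ((U ξ).toReal + (U η).toReal) := by
    set a := ⨍ y in Metric.ball η ρ, φ y
    set b := ⨍ y in Metric.ball ξ (2 * ρ), φ y
    -- The chain runs from `l` through the means over `B(ξ, 2ρ)` and `B(η, ρ)` to `l'`.
    have h6 : |l - l'| ≤ |b - l| + |a - b| + |a - l'| := by
      have : l - l' = -(b - l) - (a - b) + (a - l') := by ring
      rw [this]
      refine (abs_add_le _ _).trans (add_le_add_left ((abs_sub _ _).trans ?_) _)
      rw [abs_neg]
    have h7 : (2 * ρ) ^ s = 2 ^ s * ρ ^ s := Real.mul_rpow zero_le_two hd.le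
    have hρs : 0 < ρ ^ s := by positivity
    have hx : 0 ≤ (U ξ).toReal := ENNReal.toReal_nonneg
    have hy : 0 ≤ (U η).toReal := ENNReal.toReal_nonneg
    have h8 : K ≤ (K + A) * 2 ^ s + 1 := by nlinarith
    calc |l - l'| ≤ A * (U ξ).toReal / (1 - 2 ^ (-s)) * (2 * ρ) ^ s +
            A * (U ξ).toReal * (2 * ρ) ^ s + A * (U η).toReal / (1 - 2 ^ (-s)) * ρ ^ s :=
          h6.trans (add_le_add (add_le_add h4 h3) h5)
      _ = ((K + A) * 2 ^ s) * (ρ ^ s * (U ξ).toReal) + K * (ρ ^ s * (U η).toReal) := by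
          rw [h7, hK]; ring
      _ ≤ C * (ρ ^ s * (U ξ).toReal) + C * (ρ ^ s * (U η).toReal) := by
          gcongr
          rw [hC]; linarith
      _ = _ := by ring
  calc ‖l - l'‖ₑ = ENNReal.ofReal |l - l'| := (Real.enorm_eq_ofReal_abs _)
    _ ≤ ENNReal.ofReal (C * ρ ^ s * ((U ξ).toReal + (U η).toReal)) :=
        ENNReal.ofReal_le_ofReal hreal
    _ = _ := by
        rw [ENNReal.ofReal_mul (by positivity), ENNReal.ofReal_mul hC0.le,
          ENNReal.ofReal_add ENNReal.toReal_nonneg ENNReal.toReal_nonneg,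
          ENNReal.ofReal_toReal hξ.ne, ENNReal.ofReal_toReal hη.ne,
          ← ENNReal.ofReal_rpow_of_pos hd, hρ, ofReal_norm]
        rfl

/-! ### Semicontinuity of the potential and avoidance of `S_φ` -/

lemma IsBV.isFiniteMeasure_variation {n : ℕ} {φ : EuclideanSpace ℝ (Fin n) → ℝ} (hφ : IsBV φ) :
    IsFiniteMeasure (gradientMeasure φ).variation := ⟨hφ.isGradientMeasure.finite_variation⟩

lemma measurable_rieszPotential {n : ℕ} (α : ℝ) (μ : Measure (EuclideanSpace ℝ (Fin n)))
    [SFinite μ] : Measurable (rieszPotential α μ) :=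
  Measurable.lintegral_prod_right'
    (f := fun z : EuclideanSpace ℝ (Fin n) × EuclideanSpace ℝ (Fin n) =>
      ‖z.1 - z.2‖ₑ ^ (α - n)) (by fun_prop)

/-- Riesz potentials are lower semicontinuous. -/
lemma isClosed_rieszPotential_le {n : ℕ} (α : ℝ) (μ : Measure (EuclideanSpace ℝ (Fin n)))
    (V : ℝ≥0∞) : IsClosed {ξ | rieszPotential α μ ξ ≤ V} := by
  refine IsSeqClosed.isClosed fun x ξ hx hlim => ?_
  have hle : ∀ i, rieszPotential α μ (x i) ≤ V := hx
  have hker : ∀ y, Tendsto (fun i => ‖x i - y‖ₑ ^ (α - n)) atTop (𝓝 (‖ξ - y‖ₑ ^ (α - n))) :=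
    fun y => ((ENNReal.continuous_rpow_const).tendsto _).comp (hlim.sub_const y).enorm
  -- Fatou's lemma; the kernel is continuous into `[0, ∞]`, also on the diagonal.
  calc rieszPotential α μ ξ
      = ∫⁻ y, liminf (fun i => ‖x i - y‖ₑ ^ (α - n)) atTop ∂μ :=
        lintegral_congr fun y => (hker y).liminf_eq.symm
    _ ≤ liminf (fun i => rieszPotential α μ (x i)) atTop := lintegral_liminf_le fun i => by fun_prop
    _ ≤ V := (liminf_le_liminf (Eventually.of_forall hle)).trans (by simp)

lemma ae_rieszPotential_lt_top {k n : ℕ} {G : Set (EuclideanSpace ℝ (Fin k))} {s : ℝ} {p : ℝ≥0∞}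
    (hp : 1 ≤ p) {φ : EuclideanSpace ℝ (Fin n) → ℝ} (hφ : IsBV φ)
    {u : EuclideanSpace ℝ (Fin k) → EuclideanSpace ℝ (Fin n)}
    (hu : AEStronglyMeasurable u (volume.restrict G)) (hV : energy G φ s p u < ∞) :
    ∀ᵐ x ∂volume.restrict G,
      rieszPotential (1 - s) (gradientMeasure φ).variation (u x) < ∞ := by
  have := hφ.isFiniteMeasure_variation
  rw [energy] at hV
  split_ifs at hV with hpt
  · exact (ENNReal.ae_le_essSup _).mono fun x hx => hx.trans_lt hV
  · have hp0 : 0 < p.toReal := ENNReal.toReal_pos (zero_lt_one.trans_le hp).ne' hpt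
    refine (ae_lt_top' ?_ hV.ne).mono fun x hx => ?_
    · exact ((measurable_rieszPotential _ _).comp_aemeasurable hu.aemeasurable).pow_const _
    · by_contra hcon
      rw [not_lt_top_iff] at hcon
      rw [hcon, ENNReal.top_rpow_of_pos hp0] at hx
      exact lt_irrefl _ hx

/-- `S_φ` is contained in the measurable set where the potential is infinite, and finite energy
makes that set null for the occupation measure. -/
lemma occupationMeasure_approxDiscontinuitySet {k n : ℕ} (hn : 0 < n)
    {G : Set (EuclideanSpace ℝ (Fin k))} {s : ℝ} (hs : 0 < s) {p : ℝ≥0∞}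
    (hp : 1 ≤ p) {φ : EuclideanSpace ℝ (Fin n) → ℝ} (hφ : IsBV φ)
    {u : EuclideanSpace ℝ (Fin k) → EuclideanSpace ℝ (Fin n)}
    (hu : AEStronglyMeasurable u (volume.restrict G)) (hV : energy G φ s p u < ∞) :
    occupationMeasure G u (approxDiscontinuitySet φ) = 0 := by
  have := hφ.isFiniteMeasure_variation
  have hm := measurable_rieszPotential (1 - s) (gradientMeasure φ).variation
  have hsub : approxDiscontinuitySet φ ⊆
      rieszPotential (1 - s) (gradientMeasure φ).variation ⁻¹' {∞} := by
    intro ξ hξ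
    by_contra hcon
    obtain ⟨l, hl, -⟩ := exists_hasApproxLimit hn hs hφ (lt_top_iff_ne_top.2 hcon)
    exact hξ ⟨l, hl⟩
  refine measure_mono_null hsub ?_
  rw [occupationMeasure, Measure.map_apply_of_aemeasurable hu.aemeasurable
    (hm (measurableSet_singleton ∞))]
  exact measure_mono_null (fun x hx => by simpa using hx)
    (ae_iff.1 (ae_rieszPotential_lt_top hp hφ hu hV))

/-! ### The Hölder case -/

lemma enorm_sub_le_fracSeminorm_top {k : ℕ} {F : Type*} [NormedAddCommGroup F]
    {G : Set (EuclideanSpace ℝ (Fin k))} {θ : ℝ} {u : EuclideanSpace ℝ (Fin k) → F}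
    {x y : EuclideanSpace ℝ (Fin k)} (hx : x ∈ G) (hy : y ∈ G) (hne : x ≠ y) :
    ‖u x - u y‖ₑ ≤ fracSeminorm G θ ∞ u * ‖x - y‖ₑ ^ θ := by
  have h0 : ‖x - y‖ₑ ≠ 0 := by simpa [sub_eq_zero] using hne
  have h1 : ‖x - y‖ₑ ^ θ ≠ 0 := (ENNReal.rpow_pos (pos_iff_ne_zero.2 h0) enorm_ne_top).ne'
  have h2 : ‖x - y‖ₑ ^ θ ≠ ∞ := ENNReal.rpow_ne_top_of_nonneg' (pos_iff_ne_zero.2 h0) enorm_ne_top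
  rw [← ENNReal.div_le_iff h1 h2, fracSeminorm, if_pos rfl]
  exact le_iSup₂_of_le y hy (le_iSup₂_of_le x hx (le_iSup_of_le hne.symm le_rfl))

lemma continuousOn_of_fracSeminorm_top_lt_top {k : ℕ} {F : Type*} [NormedAddCommGroup F]
    {G : Set (EuclideanSpace ℝ (Fin k))} {θ : ℝ} (hθ : 0 < θ) {u : EuclideanSpace ℝ (Fin k) → F}
    (hfin : fracSeminorm G θ ∞ u < ∞) : ContinuousOn u G := by
  intro x hx
  rw [ContinuousWithinAt, tendsto_iff_edist_tendsto_0]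
  have hlim : Tendsto (fun y => fracSeminorm G θ ∞ u * ‖y - x‖ₑ ^ θ) (𝓝[G] x) (𝓝 0) := by
    have h1 : Tendsto (fun y => ‖y - x‖ₑ ^ θ) (𝓝 x) (𝓝 (‖x - x‖ₑ ^ θ)) :=
      ((ENNReal.continuous_rpow_const).comp (continuous_id.sub continuous_const).enorm).tendsto x
    rw [sub_self, enorm_zero, ENNReal.zero_rpow_of_pos hθ] at h1
    have h2 := ENNReal.Tendsto.const_mul (a := fracSeminorm G θ ∞ u) h1 (Or.inr hfin.ne)
    rw [mul_zero] at h2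
    exact h2.mono_left nhdsWithin_le_nhds
  refine tendsto_of_tendsto_of_tendsto_of_le_of_le' tendsto_const_nhds hlim
    (Eventually.of_forall fun _ => zero_le) ?_
  filter_upwards [self_mem_nhdsWithin] with y hy
  rcases eq_or_ne y x with rfl | hne
  · simp
  · rw [edist_eq_enorm_sub]
    exact enorm_sub_le_fracSeminorm_top hy hx hne

/-- The Hölder case of the composition estimate. -/
lemma fracSeminorm_top_comp_le {k n : ℕ} {G : Set (EuclideanSpace ℝ (Fin k))} (hG : IsOpen G)
    {s θ β : ℝ} (hs : 0 < s) (hθ : 0 < θ) (hβ : β ≤ θ * s) {d : ℝ≥0∞}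
    (hd : ∀ x ∈ G, ∀ y ∈ G, ‖x - y‖ₑ ≤ d)
    {φ ψ : EuclideanSpace ℝ (Fin n) → ℝ}
    {u : EuclideanSpace ℝ (Fin k) → EuclideanSpace ℝ (Fin n)} {C : ℝ≥0∞}
    (hC : ∀ ξ η, ‖ψ ξ - ψ η‖ₑ ≤ C * ‖ξ - η‖ₑ ^ s *
      (rieszPotential (1 - s) (gradientMeasure φ).variation ξ +
        rieszPotential (1 - s) (gradientMeasure φ).variation η))
    (hu : fracSeminorm G θ ∞ u < ∞) :
    fracSeminorm G β ∞ (fun x => ψ (u x)) ≤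
      2 * C * d ^ (θ * s - β) * fracSeminorm G θ ∞ u ^ s * energy G φ s ∞ u := by
  set V := energy G φ s ∞ u with hV
  set N := fracSeminorm G θ ∞ u
  set S := {ξ | rieszPotential (1 - s) (gradientMeasure φ).variation ξ ≤ V} with hS
  have hScl : IsClosed S := isClosed_rieszPotential_le _ _ _
  have hae : ∀ᵐ x ∂volume.restrict G, u x ∈ S := by
    rw [energy, if_pos rfl] at hV
    simp only [hS, hV, mem_ofPred_eq]
    exact ENNReal.ae_le_essSup _
  -- The exceptional set is open, as `u` is continuous on `G` and `S` is closed; being null, it is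
  -- empty.
  have hall : ∀ x ∈ G, u x ∈ S := by
    have hopen : IsOpen (G ∩ u ⁻¹' Sᶜ) :=
      (continuousOn_of_fracSeminorm_top_lt_top hθ hu).isOpen_inter_preimage hG hScl.isOpen_compl
    have hnull : volume (G ∩ u ⁻¹' Sᶜ) = 0 := by
      have := ae_iff.1 hae
      rw [Measure.restrict_apply' hG.measurableSet] at this
      rwa [inter_comm]
    have hemp := hopen.measure_eq_zero_iff volume |>.1 hnull
    intro x hx
    by_contra hcon
    exact (hemp ▸ ⟨hx, hcon⟩ : x ∈ (∅ : Set _))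
  rw [fracSeminorm, if_pos rfl]
  refine iSup₂_le fun x hx => iSup₂_le fun y hy => iSup_le fun hne => ?_
  have h0 : ‖y - x‖ₑ ≠ 0 := by simpa [sub_eq_zero] using hne.symm
  set D := ‖y - x‖ₑ with hD
  have hDt : D ≠ ∞ := enorm_ne_top
  calc ‖ψ (u y) - ψ (u x)‖ₑ / D ^ β
      ≤ (C * (N * D ^ θ) ^ s * (V + V)) / D ^ β := by
        gcongr
        refine (hC _ _).trans ?_
        gcongr
        · exact enorm_sub_le_fracSeminorm_top hy hx hne.symm
        · exact hall y hy
        · exact hall x hx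
    _ = 2 * C * D ^ (θ * s - β) * N ^ s * V := by
        rw [ENNReal.mul_rpow_of_nonneg _ _ hs.le, ← ENNReal.rpow_mul, ENNReal.rpow_sub _ _ h0 hDt,
          div_eq_mul_inv, div_eq_mul_inv]
        ring
    _ ≤ _ := by
        gcongr
        exact hd y hy x hx

/-! ### Finite `r`: Hölder's inequality with a singular kernel -/

lemma setLIntegral_ball_enorm_rpow_lt_top {k : ℕ} (hk : 0 < k) {ε : ℝ} (hε : 0 < ε) (R : ℝ) :
    ∫⁻ z in Metric.ball (0 : EuclideanSpace ℝ (Fin k)) R, ‖z‖ₑ ^ (ε - k) < ∞ := by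
  have hnt : Nontrivial (EuclideanSpace ℝ (Fin k)) :=
    Module.nontrivial_of_finrank_pos (R := ℝ) (by simpa using hk)
  have hint : IntegrableOn (fun z : EuclideanSpace ℝ (Fin k) => ‖z‖ ^ (ε - k))
      (Metric.ball 0 R) := by
    refine integrableOn_ball_of_norm_le_rpow (C := 1) (α := k - ε)
      (by simpa using Nat.succ_le_of_lt hk)
      (by simpa using hε) (Eventually.of_forall fun z => ?_)
      (Measurable.aestronglyMeasurable (by fun_prop))
    rw [neg_sub, one_mul, Real.norm_of_nonneg (by positivity)]
  have hlt := hint.hasFiniteIntegral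
  refine lt_of_le_of_lt (lintegral_mono_ae ?_) hlt
  -- The origin is removed because negative powers of 0 are infinite in `ℝ≥0∞` but 0 in `ℝ`.
  filter_upwards [ae_restrict_of_ae (Measure.ae_ne volume (0 : EuclideanSpace ℝ (Fin k)))]
    with z hz
  have hz0 : 0 < ‖z‖ := norm_pos_iff.2 hz
  rw [← ofReal_norm, ENNReal.ofReal_rpow_of_pos hz0, Real.enorm_of_nonneg (by positivity)]

/-- Hölder's inequality for the weighted double integral controlling the composition. -/
lemma lintegral_lintegral_weighted_le {k : ℕ} {G : Set (EuclideanSpace ℝ (Fin k))}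
    (hG : MeasurableSet G) {F : Type*} [NormedAddCommGroup F]
    {u : EuclideanSpace ℝ (Fin k) → F} {w f₂ : EuclideanSpace ℝ (Fin k) → ℝ≥0∞}
    {f₁ : EuclideanSpace ℝ (Fin k) → EuclideanSpace ℝ (Fin k) → ℝ≥0∞}
    {a b c r s θ β ε : ℝ} (ha : 0 ≤ a) (hb : 0 ≤ b) (hc : 0 ≤ c) (habc : a + b + c = 1)
    (hr : 0 < r) (hs : 0 < s) (he : 0 ≤ (θ * s - β) * r - ε * (b + c))
    {A B M d : ℝ≥0∞} (hd : ∀ x ∈ G, ∀ y ∈ G, ‖x - y‖ₑ ≤ d)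
    (hM : ∀ x ∈ G, ∫⁻ y in G, ‖x - y‖ₑ ^ (ε - k) ≤ M)
    (hf₁m : AEMeasurable (Function.uncurry f₁) ((volume.restrict G).prod (volume.restrict G)))
    (hf₂m : AEMeasurable f₂ (volume.restrict G))
    (hf₁ : ∀ x ∈ G, ∀ y ∈ G, x ≠ y →
      ‖u x - u y‖ₑ ^ (s * r) ≤ A * f₁ x y ^ a * ‖x - y‖ₑ ^ (k * a + θ * s * r))
    (hf₂ : ∀ᵐ x ∂volume.restrict G, w x ^ r ≤ B * f₂ x ^ b) :
    ∫⁻ x in G, ∫⁻ y in G, ‖u x - u y‖ₑ ^ (s * r) * w x ^ r / ‖x - y‖ₑ ^ (k + β * r) ≤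
      (A * (∫⁻ x in G, ∫⁻ y in G, f₁ x y) ^ a) * (B * (∫⁻ x in G, f₂ x) ^ b) *
        (M ^ b * (M * volume G) ^ c * d ^ ((θ * s - β) * r - ε * (b + c))) := by
  set e := (θ * s - β) * r - ε * (b + c) with he'
  set ν := volume.restrict G with hν
  set H : Fin 3 → EuclideanSpace ℝ (Fin k) × EuclideanSpace ℝ (Fin k) → ℝ≥0∞ :=
    ![Function.uncurry f₁, fun z => f₂ z.1 * ‖z.1 - z.2‖ₑ ^ (ε - k),
      fun z => ‖z.1 - z.2‖ₑ ^ (ε - k)] with hH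
  have hker : Measurable fun z : EuclideanSpace ℝ (Fin k) × EuclideanSpace ℝ (Fin k) =>
      ‖z.1 - z.2‖ₑ ^ (ε - k) := by fun_prop
  have hHm : ∀ i ∈ Finset.univ, AEMeasurable (H i) (ν.prod ν) := by
    intro i _
    fin_cases i
    · exact hf₁m
    · exact hf₂m.comp_fst.mul hker.aemeasurable
    · exact hker.aemeasurable
  have hpt : ∀ᵐ x ∂ν, ∀ᵐ y ∂ν,
      ‖u x - u y‖ₑ ^ (s * r) * w x ^ r / ‖x - y‖ₑ ^ (k + β * r) ≤
        A * B * d ^ e * ∏ i, H i (x, y) ^ (![a, b, c] i) := by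
    filter_upwards [hf₂, ae_restrict_mem hG] with x hx hxG
    filter_upwards [ae_restrict_mem hG] with y hyG
    rcases eq_or_ne x y with rfl | hne
    · rw [sub_self, enorm_zero, ENNReal.zero_rpow_of_pos (by positivity), zero_mul,
        ENNReal.zero_div]
      exact zero_le
    have h0 : ‖x - y‖ₑ ≠ 0 := by simpa [sub_eq_zero] using hne
    have hde := hd x hxG y hyG
    have h1 := hf₁ x hxG y hyG hne
    set D := ‖x - y‖ₑ with hD
    have hDt : D ≠ ∞ := enorm_ne_top
    -- Since `a - 1 = -(b + c)`, the surplus power of the distance splits into the kernels of the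
    -- second and third Hölder factors and the bounded remainder `D ^ e`.
    have hDe : D ^ (k * a + θ * s * r) / D ^ (k + β * r) =
        D ^ ((ε - k) * b) * D ^ ((ε - k) * c) * D ^ e := by
      rw [← ENNReal.rpow_sub _ _ h0 hDt, ← ENNReal.rpow_add _ _ h0 hDt,
        ← ENNReal.rpow_add _ _ h0 hDt]
      congr 1
      rw [he', show a = 1 - b - c by linarith]
      ring
    calc ‖u x - u y‖ₑ ^ (s * r) * w x ^ r / D ^ (k + β * r)
        ≤ (A * f₁ x y ^ a * D ^ (k * a + θ * s * r)) * (B * f₂ x ^ b) / D ^ (k + β * r) := by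
          gcongr
      _ = A * B * f₁ x y ^ a * f₂ x ^ b * (D ^ (k * a + θ * s * r) / D ^ (k + β * r)) := by
          rw [div_eq_mul_inv, div_eq_mul_inv]; ring
      _ = A * B * D ^ e * (f₁ x y ^ a * (f₂ x * D ^ (ε - k)) ^ b * (D ^ (ε - k)) ^ c) := by
          rw [hDe, ENNReal.mul_rpow_of_nonneg _ _ hb, ← ENNReal.rpow_mul, ← ENNReal.rpow_mul]
          ring
      _ ≤ A * B * d ^ e * (f₁ x y ^ a * (f₂ x * D ^ (ε - k)) ^ b * (D ^ (ε - k)) ^ c) := by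
          gcongr
      _ = _ := by
          rw [Fin.prod_univ_three]
          rfl
  have hHm' : AEMeasurable (fun z => ∏ i, H i z ^ (![a, b, c] i)) (ν.prod ν) :=
    Finset.aemeasurable_fun_prod _ fun i hi => (hHm i hi).pow_const _
  have hI₂ : ∫⁻ z, H 1 z ∂ν.prod ν ≤ M * ∫⁻ x in G, f₂ x := by
    rw [lintegral_prod _ (hHm 1 (Finset.mem_univ _)), mul_comm, ← lintegral_mul_const'' _ hf₂m]
    refine setLIntegral_mono' hG fun x hx => ?_
    simp only [hH, Matrix.cons_val_one, Matrix.cons_val_zero]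
    rw [lintegral_const_mul _ (by fun_prop)]
    gcongr
    exact hM x hx
  have hI₃ : ∫⁻ z, H 2 z ∂ν.prod ν ≤ M * volume G := by
    rw [lintegral_prod _ (hHm 2 (Finset.mem_univ _)), ← setLIntegral_const]
    exact setLIntegral_mono' hG fun x hx => hM x hx
  calc ∫⁻ x in G, ∫⁻ y in G, ‖u x - u y‖ₑ ^ (s * r) * w x ^ r / ‖x - y‖ₑ ^ (k + β * r)
      ≤ ∫⁻ x, ∫⁻ y, A * B * d ^ e * ∏ i, H i (x, y) ^ (![a, b, c] i) ∂ν ∂ν :=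
        lintegral_mono_ae (hpt.mono fun x hx => lintegral_mono_ae hx)
    _ = A * B * d ^ e * ∫⁻ z, ∏ i, H i z ^ (![a, b, c] i) ∂ν.prod ν := by
        rw [← lintegral_const_mul'' _ hHm', lintegral_prod _ (hHm'.const_mul _)]
    _ ≤ A * B * d ^ e * ∏ i, (∫⁻ z, H i z ∂ν.prod ν) ^ (![a, b, c] i) := by
        gcongr
        refine ENNReal.lintegral_prod_norm_pow_le _ hHm ?_ ?_
        · simpa [Fin.sum_univ_three] using habc
        · intro i _
          fin_cases i <;> simpa
    _ ≤ A * B * d ^ e * ((∫⁻ x in G, ∫⁻ y in G, f₁ x y) ^ a * (M * ∫⁻ x in G, f₂ x) ^ b *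
          (M * volume G) ^ c) := by
        rw [Fin.prod_univ_three]
        exact mul_le_mul' le_rfl (mul_le_mul' (mul_le_mul'
          (ENNReal.rpow_le_rpow (lintegral_prod _ hf₁m).le ha) (ENNReal.rpow_le_rpow hI₂ hb))
          (ENNReal.rpow_le_rpow hI₃ hc))
    _ = _ := by
        rw [ENNReal.mul_rpow_of_nonneg _ _ hb]
        ring

/-- Passage from the weighted double integral to the Gagliardo seminorm. -/
lemma fracSeminorm_le_of_pointwise {k : ℕ} {G : Set (EuclideanSpace ℝ (Fin k))}
    {F F' : Type*} [NormedAddCommGroup F] [NormedAddCommGroup F']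
    {u : EuclideanSpace ℝ (Fin k) → F} {g : EuclideanSpace ℝ (Fin k) → F'}
    {w : EuclideanSpace ℝ (Fin k) → ℝ≥0∞}
    (hu : AEStronglyMeasurable u (volume.restrict G)) (hw : AEMeasurable w (volume.restrict G))
    {s β : ℝ} {r C I : ℝ≥0∞} (hr : 1 ≤ r) (hrt : r ≠ ∞)
    (hg : ∀ x y, ‖g x - g y‖ₑ ≤ C * ‖u x - u y‖ₑ ^ s * (w x + w y))
    (hI : ∫⁻ x in G, ∫⁻ y in G,
      ‖u x - u y‖ₑ ^ (s * r.toReal) * w x ^ r.toReal / ‖x - y‖ₑ ^ (k + β * r.toReal) ≤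
        I ^ r.toReal) :
    fracSeminorm G β r g ≤ 4 * C * I := by
  have hr0 : 0 < r.toReal := ENNReal.toReal_pos (zero_lt_one.trans_le hr).ne' hrt
  have hr1 : 1 ≤ r.toReal := by simpa using ENNReal.toReal_mono hrt hr
  set ρ := r.toReal with hρ
  set ν := volume.restrict G
  let J : EuclideanSpace ℝ (Fin k) → EuclideanSpace ℝ (Fin k) → ℝ≥0∞ := fun x y =>
    ‖u x - u y‖ₑ ^ (s * ρ) * w x ^ ρ / ‖x - y‖ₑ ^ (k + β * ρ)
  have hJm : AEMeasurable (Function.uncurry J) (ν.prod ν) := by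
    have h1 : AEMeasurable (fun z : EuclideanSpace ℝ (Fin k) × EuclideanSpace ℝ (Fin k) =>
        ‖u z.1 - u z.2‖ₑ) (ν.prod ν) := (hu.comp_fst.sub hu.comp_snd).enorm
    have h2 : AEMeasurable (fun z : EuclideanSpace ℝ (Fin k) × EuclideanSpace ℝ (Fin k) =>
        w z.1) (ν.prod ν) := hw.comp_fst
    exact ((h1.pow_const _).mul (h2.pow_const _)).div (Measurable.aemeasurable (by fun_prop))
  -- By symmetry, the weight at `y` contributes as much as the weight at `x`.
  have hswap : ∫⁻ x, ∫⁻ y, J y x ∂ν ∂ν = ∫⁻ x, ∫⁻ y, J x y ∂ν ∂ν :=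
    (lintegral_lintegral_swap hJm).symm
  have hJs : AEMeasurable (fun z : EuclideanSpace ℝ (Fin k) × EuclideanSpace ℝ (Fin k) =>
      J z.2 z.1) (ν.prod ν) := hJm.prod_swap
  have hpt : ∀ x y, ‖g x - g y‖ₑ ^ ρ / ‖x - y‖ₑ ^ (k + β * ρ) ≤
      (C * 2) ^ ρ * (J x y + J y x) := by
    intro x y
    have hmax : (w x + w y) ^ ρ ≤ 2 ^ ρ * (w x ^ ρ + w y ^ ρ) := by
      have h1 : w x + w y ≤ 2 * max (w x) (w y) := by
        rw [two_mul]; exact add_le_add (le_max_left _ _) (le_max_right _ _)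
      refine (ENNReal.rpow_le_rpow h1 hr0.le).trans ?_
      rw [ENNReal.mul_rpow_of_nonneg _ _ hr0.le]
      gcongr
      rcases max_choice (w x) (w y) with h | h <;> rw [h]
      · exact le_self_add
      · exact le_add_self
    calc ‖g x - g y‖ₑ ^ ρ / ‖x - y‖ₑ ^ (k + β * ρ)
        ≤ (C * ‖u x - u y‖ₑ ^ s * (w x + w y)) ^ ρ / ‖x - y‖ₑ ^ (k + β * ρ) := by
          gcongr
          exact hg x y
      _ = C ^ ρ * ‖u x - u y‖ₑ ^ (s * ρ) * (w x + w y) ^ ρ / ‖x - y‖ₑ ^ (k + β * ρ) := by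
          rw [ENNReal.mul_rpow_of_nonneg _ _ hr0.le, ENNReal.mul_rpow_of_nonneg _ _ hr0.le,
            ENNReal.rpow_mul]
      _ ≤ C ^ ρ * ‖u x - u y‖ₑ ^ (s * ρ) * (2 ^ ρ * (w x ^ ρ + w y ^ ρ)) /
            ‖x - y‖ₑ ^ (k + β * ρ) := by gcongr
      _ = _ := by
          simp only [J]
          rw [enorm_sub_rev (u y), enorm_sub_rev y, ENNReal.mul_rpow_of_nonneg _ _ hr0.le,
            div_eq_mul_inv, div_eq_mul_inv, div_eq_mul_inv]
          ring
  have hmain : ∫⁻ x in G, ∫⁻ y in G, ‖g x - g y‖ₑ ^ ρ / ‖x - y‖ₑ ^ (k + β * ρ) ≤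
      (C * 2) ^ ρ * (2 * I ^ ρ) := by
    calc _ ≤ ∫⁻ x, ∫⁻ y, (C * 2) ^ ρ * (J x y + J y x) ∂ν ∂ν :=
          lintegral_mono fun x => lintegral_mono fun y => hpt x y
      _ = (C * 2) ^ ρ * (∫⁻ x, ∫⁻ y, J x y ∂ν ∂ν + ∫⁻ x, ∫⁻ y, J y x ∂ν ∂ν) := by
          have h1 : ∫⁻ z, Function.uncurry J z ∂ν.prod ν = ∫⁻ x, ∫⁻ y, J x y ∂ν ∂ν :=
            lintegral_prod _ hJm
          have h2 : ∫⁻ z, J z.2 z.1 ∂ν.prod ν = ∫⁻ x, ∫⁻ y, J y x ∂ν ∂ν := lintegral_prod _ hJs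
          have h3 : AEMeasurable (fun z : EuclideanSpace ℝ (Fin k) × EuclideanSpace ℝ (Fin k) =>
              Function.uncurry J z + J z.2 z.1) (ν.prod ν) := hJm.add hJs
          rw [← h1, ← h2, ← lintegral_add_left' hJm, ← lintegral_const_mul'' _ h3]
          exact (lintegral_prod _ (h3.const_mul _)).symm
      _ ≤ _ := by
          rw [hswap, ← two_mul]
          gcongr
  rw [fracSeminorm, if_neg hrt, ← hρ]
  calc _ ≤ ((C * 2) ^ ρ * (2 * I ^ ρ)) ^ (1 / ρ) := by gcongr
    _ = C * 2 * (2 ^ (1 / ρ) * I) := by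
        rw [ENNReal.mul_rpow_of_nonneg ((C * 2) ^ ρ) _ (by positivity),
          ENNReal.mul_rpow_of_nonneg 2 _ (by positivity), ← ENNReal.rpow_mul, ← ENNReal.rpow_mul,
          mul_one_div_cancel hr0.ne', ENNReal.rpow_one, ENNReal.rpow_one]
    -- As `r ≥ 1`, `2 ^ (1 / r)` is at most 2, which makes the factor 4 independent of `r`.
    _ ≤ C * 2 * (2 ^ (1 : ℝ) * I) := by
        gcongr
        · exact one_le_two
        · rw [div_le_one hr0]; exact hr1
    _ = _ := by rw [ENNReal.rpow_one]; ring

lemma MemSobolev.fracSeminorm_lt_top {k : ℕ} {F : Type*} [NormedAddCommGroup F]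
    {G : Set (EuclideanSpace ℝ (Fin k))} {θ : ℝ} {u : EuclideanSpace ℝ (Fin k) → F}
    (hu : MemSobolev G θ ∞ u) : fracSeminorm G θ ∞ u < ∞ := by
  have := hu.2
  rw [sobolevNorm, if_pos rfl] at this
  exact (ENNReal.add_lt_top.1 this).2

/-- The composition estimate for finite `r`, with explicit dependence on the domain through
its diameter, its volume and a bound `M` for the integral of the kernel `|x - y| ^ (θs - β - k)`. -/
lemma fracSeminorm_comp_le {k n : ℕ} {G : Set (EuclideanSpace ℝ (Fin k))} (hG : MeasurableSet G)
    {s θ β : ℝ} (hs : 0 < s) (hβ : β ≤ θ * s)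
    {p q r : ℝ≥0∞} (hp : 1 ≤ p) (hq : 1 ≤ q) (hr : 1 ≤ r) (hrt : r ≠ ∞)
    {a b c : ℝ} (ha : a = s * r.toReal * (q⁻¹).toReal) (hb : b = r.toReal * (p⁻¹).toReal)
    (hc : 0 ≤ c) (habc : a + b + c = 1)
    {d M : ℝ≥0∞} (hd : ∀ x ∈ G, ∀ y ∈ G, ‖x - y‖ₑ ≤ d)
    (hM : ∀ x ∈ G, ∫⁻ y in G, ‖x - y‖ₑ ^ (θ * s - β - k) ≤ M)
    {φ ψ : EuclideanSpace ℝ (Fin n) → ℝ} (hφ : IsBV φ)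
    {u : EuclideanSpace ℝ (Fin k) → EuclideanSpace ℝ (Fin n)}
    (hu : AEStronglyMeasurable u (volume.restrict G)) {C : ℝ≥0∞}
    (hC : ∀ ξ η, ‖ψ ξ - ψ η‖ₑ ≤ C * ‖ξ - η‖ₑ ^ s *
      (rieszPotential (1 - s) (gradientMeasure φ).variation ξ +
        rieszPotential (1 - s) (gradientMeasure φ).variation η)) :
    fracSeminorm G β r (fun x => ψ (u x)) ≤
      4 * C * (fracSeminorm G θ q u ^ s *
        (if p = ∞ then energy G φ s p u else energy G φ s p u ^ (1 / p.toReal)) *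
        (M ^ b * (M * volume G) ^ c *
          d ^ ((θ * s - β) * r.toReal - (θ * s - β) * (b + c))) ^ (1 / r.toReal)) := by
  have := hφ.isFiniteMeasure_variation
  have hr0 : 0 < r.toReal := ENNReal.toReal_pos (zero_lt_one.trans_le hr).ne' hrt
  have hr1 : 1 ≤ r.toReal := by simpa using ENNReal.toReal_mono hrt hr
  set ρ := r.toReal with hρ
  have ha0 : 0 ≤ a := by rw [ha]; positivity
  have hb0 : 0 ≤ b := by rw [hb]; positivity
  have he : 0 ≤ (θ * s - β) * ρ - (θ * s - β) * (b + c) := by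
    have h1 : b + c ≤ ρ := by linarith
    nlinarith
  set U := rieszPotential (1 - s) (gradientMeasure φ).variation with hU
  have hw : AEMeasurable (fun x => U (u x)) (volume.restrict G) :=
    (measurable_rieszPotential _ _).comp_aemeasurable hu.aemeasurable
  set N := fracSeminorm G θ q u with hN
  set E := if p = ∞ then energy G φ s p u else energy G φ s p u ^ (1 / p.toReal) with hE
  -- For finite `q`, `f₁` is the Gagliardo density and `A = 1`. For `q = ∞` the exponent `a` is 0,
  -- and the Hölder seminorm is carried by `A`.
  obtain ⟨A, f₁, hf₁m, hf₁, hAf₁⟩ : ∃ (A : ℝ≥0∞)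
      (f₁ : EuclideanSpace ℝ (Fin k) → EuclideanSpace ℝ (Fin k) → ℝ≥0∞),
      AEMeasurable (Function.uncurry f₁) ((volume.restrict G).prod (volume.restrict G)) ∧
      (∀ x ∈ G, ∀ y ∈ G, x ≠ y →
        ‖u x - u y‖ₑ ^ (s * ρ) ≤ A * f₁ x y ^ a * ‖x - y‖ₑ ^ (k * a + θ * s * ρ)) ∧
      A * (∫⁻ x in G, ∫⁻ y in G, f₁ x y) ^ a = (N ^ s) ^ ρ := by
    rcases eq_or_ne q ∞ with hqt | hqt
    · have ha' : a = 0 := by rw [ha, hqt]; simp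
      refine ⟨(N ^ s) ^ ρ, fun _ _ => 1, aemeasurable_const, fun x hx y hy hne => ?_, ?_⟩
      · rw [ha', ENNReal.rpow_zero, mul_one, mul_zero, zero_add, ENNReal.rpow_mul]
        have h1 := enorm_sub_le_fracSeminorm_top (θ := θ) (u := u) hx hy hne
        rw [← hqt, ← hN] at h1
        refine (ENNReal.rpow_le_rpow (ENNReal.rpow_le_rpow h1 hs.le) hr0.le).trans_eq ?_
        rw [ENNReal.mul_rpow_of_nonneg _ _ hs.le, ENNReal.mul_rpow_of_nonneg _ _ hr0.le,
          ← ENNReal.rpow_mul (‖x - y‖ₑ), ← ENNReal.rpow_mul (‖x - y‖ₑ)]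
      · rw [ha', ENNReal.rpow_zero, mul_one]
    · have hq0 : 0 < q.toReal := ENNReal.toReal_pos (zero_lt_one.trans_le hq).ne' hqt
      have ha' : q.toReal * a = s * ρ := by
        rw [ha, ENNReal.toReal_inv]; field_simp
      refine ⟨1, fun x y => ‖u x - u y‖ₑ ^ q.toReal / ‖x - y‖ₑ ^ (k + θ * q.toReal), ?_,
        fun x hx y hy hne => ?_, ?_⟩
      · have h1 : AEMeasurable (fun z : EuclideanSpace ℝ (Fin k) × EuclideanSpace ℝ (Fin k) =>
            ‖u z.1 - u z.2‖ₑ) ((volume.restrict G).prod (volume.restrict G)) :=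
          (hu.comp_fst.sub hu.comp_snd).enorm
        exact (h1.pow_const _).div (Measurable.aemeasurable (by fun_prop))
      · have h0 : ‖x - y‖ₑ ≠ 0 := by simpa [sub_eq_zero] using hne
        have hx1 : k * a + θ * s * ρ = (k + θ * q.toReal) * a := by
          rw [mul_assoc θ, ← ha']; ring
        rw [one_mul, hx1, ENNReal.rpow_mul (‖x - y‖ₑ), ← ENNReal.mul_rpow_of_nonneg _ _ ha0,
          ENNReal.div_mul_cancel, ← ENNReal.rpow_mul, ha']
        · exact (ENNReal.rpow_pos (pos_iff_ne_zero.2 h0) enorm_ne_top).ne'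
        · exact ENNReal.rpow_ne_top_of_nonneg' (pos_iff_ne_zero.2 h0) enorm_ne_top
      · rw [one_mul, hN, fracSeminorm, if_neg hqt, ← ENNReal.rpow_mul, ← ENNReal.rpow_mul]
        congr 1
        rw [ha, ENNReal.toReal_inv]
        ring
  -- The same device for the energy: `f₂` carries it for finite `p`, and the constant `B` for `p =
  -- ∞`.
  obtain ⟨B, f₂, hf₂m, hf₂, hBf₂⟩ : ∃ (B : ℝ≥0∞) (f₂ : EuclideanSpace ℝ (Fin k) → ℝ≥0∞),
      AEMeasurable f₂ (volume.restrict G) ∧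
      (∀ᵐ x ∂volume.restrict G, U (u x) ^ ρ ≤ B * f₂ x ^ b) ∧
      B * (∫⁻ x in G, f₂ x) ^ b = E ^ ρ := by
    rcases eq_or_ne p ∞ with hpt | hpt
    · have hb' : b = 0 := by rw [hb, hpt]; simp
      refine ⟨E ^ ρ, fun _ => 1, aemeasurable_const, ?_, ?_⟩
      · rw [hE, if_pos hpt, energy, if_pos hpt]
        refine (ENNReal.ae_le_essSup (fun x => U (u x))).mono fun x hx => ?_
        rw [hb', ENNReal.rpow_zero, mul_one]
        exact ENNReal.rpow_le_rpow hx hr0.le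
      · rw [hb', ENNReal.rpow_zero, mul_one]
    · have hp0 : 0 < p.toReal := ENNReal.toReal_pos (zero_lt_one.trans_le hp).ne' hpt
      refine ⟨1, fun x => U (u x) ^ p.toReal, hw.pow_const _, Eventually.of_forall fun x => ?_, ?_⟩
      · rw [one_mul, ← ENNReal.rpow_mul, hb, ENNReal.toReal_inv]
        refine le_of_eq (congrArg _ ?_)
        field_simp
      · rw [hE, if_neg hpt, energy, if_neg hpt, one_mul, ← ENNReal.rpow_mul]
        congr 1
        rw [hb, ENNReal.toReal_inv]
        ring
  refine fracSeminorm_le_of_pointwise hu hw hr hrt (fun x y => hC (u x) (u y)) ?_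
  refine (lintegral_lintegral_weighted_le hG ha0 hb0 hc habc hr0 hs he hd hM hf₁m hf₂m hf₁
    hf₂).trans_eq ?_
  rw [hAf₁, hBf₂, ENNReal.mul_rpow_of_nonneg _ _ hr0.le, ENNReal.mul_rpow_of_nonneg _ _ hr0.le,
    ← ENNReal.rpow_mul _ (1 / ρ), one_div_mul_cancel hr0.ne', ENNReal.rpow_one]

/-! ### Uniform constants and conclusion -/

lemma classSeminormLE_of_fracSeminorm_le {k : ℕ} {F : Type*} [NormedAddCommGroup F]
    {G : Set (EuclideanSpace ℝ (Fin k))} {δ : ℝ} {l : ℝ≥0∞} {f : EuclideanSpace ℝ (Fin k) → F}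
    {C : ℝ≥0∞} (h : fracSeminorm G δ l f ≤ C) : ClassSeminormLE G δ l f C :=
  ⟨f, Filter.EventuallyEq.rfl, h⟩

/-- The composition estimate on domains of diameter at most `R`, away from the endpoint. -/
lemma exists_const_fracSeminorm_comp_le {k n : ℕ} (hk : 0 < k) {s θ β : ℝ} (hs : 0 < s)
    (hθ : 0 < θ) {p q r : ℝ≥0∞} (hp : 1 ≤ p) (hq : 1 ≤ q) (hr : 1 ≤ r)
    (hpqr : p⁻¹ + ENNReal.ofReal s / q ≤ r⁻¹)
    (hβ : β < θ * s ∨ (β = θ * s ∧ (r = ∞ ∨ (r ≠ ∞ ∧ q = ENNReal.ofReal s * r))))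
    (C : ℝ≥0) (R : ℝ) :
    ∃ c : ℝ≥0, 0 < c ∧ (β = θ * s → c = 4 * C + 1) ∧
      ∀ G : Set (EuclideanSpace ℝ (Fin k)), IsOpen G → Bornology.IsBounded G →
        Metric.diam G ≤ R →
        ∀ (φ ψ : EuclideanSpace ℝ (Fin n) → ℝ)
          (u : EuclideanSpace ℝ (Fin k) → EuclideanSpace ℝ (Fin n)), IsBV φ →
        MemSobolev G θ q u →
        (∀ ξ η, ‖ψ ξ - ψ η‖ₑ ≤ C * ‖ξ - η‖ₑ ^ s *
          (rieszPotential (1 - s) (gradientMeasure φ).variation ξ +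
            rieszPotential (1 - s) (gradientMeasure φ).variation η)) →
        fracSeminorm G β r (fun x => ψ (u x)) ≤ c * fracSeminorm G θ q u ^ s *
          (if p = ∞ then energy G φ s p u else energy G φ s p u ^ (1 / p.toReal)) := by
  have hβ' : β ≤ θ * s := by rcases hβ with h | h <;> linarith
  -- Adding 1 makes `d` positive for every real `R` and strictly larger than all distances in `G`,
  -- so differences lie in an open ball.
  set d : ℝ := max R 0 + 1 with hd
  have hd0 : 0 < d := by positivity
  have hdG : ∀ G : Set (EuclideanSpace ℝ (Fin k)), Bornology.IsBounded G → Metric.diam G ≤ R →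
      ∀ x ∈ G, ∀ y ∈ G, ‖x - y‖ < d := by
    intro G hGb hGR x hx y hy
    rw [← dist_eq_norm]
    linarith [Metric.dist_le_diam_of_mem hGb hx hy, le_max_left R 0]
  have hdG' : ∀ G : Set (EuclideanSpace ℝ (Fin k)), Bornology.IsBounded G → Metric.diam G ≤ R →
      ∀ x ∈ G, ∀ y ∈ G, ‖x - y‖ₑ ≤ ENNReal.ofReal d := by
    intro G hGb hGR x hx y hy
    rw [← ofReal_norm]
    exact ENNReal.ofReal_le_ofReal (hdG G hGb hGR x hx y hy).le
  -- All dependence on `R` sits in `κ`, which is 1 at the endpoint.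
  suffices h : ∃ κ : ℝ≥0∞, κ ≠ ∞ ∧ (β = θ * s → κ = 1) ∧
      ∀ G : Set (EuclideanSpace ℝ (Fin k)), IsOpen G → Bornology.IsBounded G →
        Metric.diam G ≤ R →
        ∀ (φ ψ : EuclideanSpace ℝ (Fin n) → ℝ)
          (u : EuclideanSpace ℝ (Fin k) → EuclideanSpace ℝ (Fin n)), IsBV φ →
        MemSobolev G θ q u →
        (∀ ξ η, ‖ψ ξ - ψ η‖ₑ ≤ C * ‖ξ - η‖ₑ ^ s *
          (rieszPotential (1 - s) (gradientMeasure φ).variation ξ +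
            rieszPotential (1 - s) (gradientMeasure φ).variation η)) →
        fracSeminorm G β r (fun x => ψ (u x)) ≤ 4 * C * κ * fracSeminorm G θ q u ^ s *
          (if p = ∞ then energy G φ s p u else energy G φ s p u ^ (1 / p.toReal)) by
    obtain ⟨κ, hκt, hκ1, hκ⟩ := h
    refine ⟨4 * C * κ.toNNReal + 1, by positivity, fun h => by simp [hκ1 h],
      fun G hG hGb hGR φ ψ u hφ hu hC => (hκ G hG hGb hGR φ ψ u hφ hu hC).trans ?_⟩
    gcongr
    push_cast
    rw [ENNReal.coe_toNNReal hκt]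
    exact le_self_add
  rcases eq_or_ne r ∞ with hrt | hrt
  · have h0 : p⁻¹ + ENNReal.ofReal s / q = 0 := by simpa [hrt] using hpqr
    have hpt : p = ∞ := by simpa using (add_eq_zero.1 h0).1
    have hqt : q = ∞ := by
      have := (add_eq_zero.1 h0).2
      rw [ENNReal.div_eq_zero_iff] at this
      exact this.resolve_left (ENNReal.ofReal_pos.2 hs).ne'
    subst hrt hpt hqt
    refine ⟨ENNReal.ofReal d ^ (θ * s - β), ENNReal.rpow_ne_top_of_nonneg (by linarith)
      ENNReal.ofReal_ne_top, fun h => by simp [h], fun G hG hGb hGR φ ψ u hφ hu hC => ?_⟩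
    rw [if_pos rfl]
    refine (fracSeminorm_top_comp_le hG hs hθ hβ' (hdG' G hGb hGR) hC
      hu.fracSeminorm_lt_top).trans ?_
    gcongr
    norm_num
  have hr0 : 0 < r.toReal := ENNReal.toReal_pos (zero_lt_one.trans_le hr).ne' hrt
  have hr1 : 1 ≤ r.toReal := by simpa using ENNReal.toReal_mono hrt hr
  have hq0 : q ≠ 0 := (zero_lt_one.trans_le hq).ne'
  have hp0 : p ≠ 0 := (zero_lt_one.trans_le hp).ne'
  have hr0' : r ≠ 0 := (zero_lt_one.trans_le hr).ne'
  set a : ℝ := s * r.toReal * (q⁻¹).toReal with ha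
  set b : ℝ := r.toReal * (p⁻¹).toReal with hb
  have hb0 : 0 ≤ b := by positivity
  have ha0 : 0 ≤ a := by positivity
  -- This is the relation between `p`, `q` and `r`, multiplied by `r`.
  have hab : a + b ≤ 1 := by
    have h1 := ENNReal.toReal_mono (ENNReal.inv_ne_top.2 hr0') hpqr
    rw [div_eq_mul_inv, ENNReal.toReal_add (ENNReal.inv_ne_top.2 hp0)
      (ENNReal.mul_ne_top ENNReal.ofReal_ne_top (ENNReal.inv_ne_top.2 hq0)), ENNReal.toReal_mul,
      ENNReal.toReal_ofReal hs.le, ENNReal.toReal_inv r] at h1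
    have h2 := mul_le_mul_of_nonneg_left h1 hr0.le
    rw [mul_inv_cancel₀ hr0.ne'] at h2
    rw [ha, hb]
    linarith
  rcases hβ'.eq_or_lt with hβe | hβlt
  · have hqr : q = ENNReal.ofReal s * r := by
      rcases hβ with h | ⟨-, h | h⟩
      · exact absurd hβe h.ne
      · exact absurd h hrt
      · exact h.2
    have ha1 : a = 1 := by
      rw [ha, hqr, ENNReal.toReal_inv, ENNReal.toReal_mul, ENNReal.toReal_ofReal hs.le]
      exact mul_inv_cancel₀ (by positivity)
    have hb' : b = 0 := by linarith
    -- The kernel bound `M = ∞` is harmless here: it occurs only to the power 0.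
    refine ⟨1, ENNReal.one_ne_top, fun _ => rfl, fun G hG hGb hGR φ ψ u hφ hu hC => ?_⟩
    refine (fracSeminorm_comp_le hG.measurableSet hs hβ' hp hq hr hrt ha hb le_rfl (by linarith)
      (hdG' G hGb hGR) (M := ∞) (fun _ _ => le_top) hφ hu.1 hC).trans_eq ?_
    simp only [hb', hβe, ENNReal.rpow_zero, sub_self, zero_mul, ENNReal.one_rpow, mul_one]
    ring
  -- Under `y ↦ x - y` every `G` of diameter at most `R` is mapped into this one ball, so `M`
  -- depends on `R` but not on `G` or `x`.
  · set M : ℝ≥0∞ := ∫⁻ z in Metric.ball (0 : EuclideanSpace ℝ (Fin k)) d,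
      ‖z‖ₑ ^ (θ * s - β - k) with hM
    have hMt : M ≠ ∞ := (setLIntegral_ball_enorm_rpow_lt_top hk (by linarith) d).ne
    set Ω := volume (Metric.ball (0 : EuclideanSpace ℝ (Fin k)) d) with hΩ
    have hΩt : Ω ≠ ∞ := measure_ball_lt_top.ne
    set e := (θ * s - β) * r.toReal - (θ * s - β) * (b + (1 - a - b)) with he'
    have he : 0 ≤ e := by
      have h1 : b + (1 - a - b) ≤ r.toReal := by linarith
      nlinarith
    refine ⟨(M ^ b * (M * Ω) ^ (1 - a - b) * ENNReal.ofReal d ^ e) ^ (1 / r.toReal), ?_,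
      fun h => absurd h hβlt.ne, fun G hG hGb hGR φ ψ u hφ hu hC => ?_⟩
    · have h1 := ENNReal.mul_ne_top hMt hΩt
      refine ENNReal.rpow_ne_top_of_nonneg (by positivity) (ENNReal.mul_ne_top
        (ENNReal.mul_ne_top (ENNReal.rpow_ne_top_of_nonneg hb0 hMt)
          (ENNReal.rpow_ne_top_of_nonneg (by linarith) h1))
        (ENNReal.rpow_ne_top_of_nonneg he ENNReal.ofReal_ne_top))
    · have hsub : ∀ x ∈ G, ∀ y ∈ G, x - y ∈ Metric.ball (0 : EuclideanSpace ℝ (Fin k)) d :=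
        fun x hx y hy => by rw [mem_ball_zero_iff]; exact hdG G hGb hGR x hx y hy
      have hMG : ∀ x ∈ G, ∫⁻ y in G, ‖x - y‖ₑ ^ (θ * s - β - k) ≤ M := by
        intro x hx
        rw [hM, ← lintegral_indicator Metric.isOpen_ball.measurableSet,
          ← lintegral_indicator hG.measurableSet,
          ← lintegral_sub_left_eq_self
            ((Metric.ball 0 d).indicator fun z => ‖z‖ₑ ^ (θ * s - β - k)) x]
        refine lintegral_mono fun y => ?_
        by_cases hy : y ∈ G
        · rw [indicator_of_mem hy, indicator_of_mem (hsub x hx y hy)]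
        · rw [indicator_of_notMem hy]
          exact zero_le
      have hΩG : volume G ≤ Ω := by
        rcases G.eq_empty_or_nonempty with rfl | ⟨x, hx⟩
        · simp
        · rw [hΩ, ← Measure.addHaar_ball_center volume x d]
          refine measure_mono fun y hy => ?_
          rw [Metric.mem_ball, dist_eq_norm]
          exact hdG G hGb hGR y hy x hx
      refine (fracSeminorm_comp_le hG.measurableSet hs hβ' hp hq hr hrt ha hb
        (c := 1 - a - b) (by linarith) (by linarith)
        (hdG' G hGb hGR) hMG hφ hu.1 hC).trans ?_
      have hκ : (M ^ b * (M * volume G) ^ (1 - a - b) * ENNReal.ofReal d ^ e) ^ (1 / r.toReal) ≤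
          (M ^ b * (M * Ω) ^ (1 - a - b) * ENNReal.ofReal d ^ e) ^ (1 / r.toReal) := by
        gcongr
        linarith
      rw [← he']
      refine (mul_le_mul' le_rfl (mul_le_mul' le_rfl hκ)).trans_eq ?_
      ring

end NonlinearComposition

theorem theoremT (k n : ℕ) (hk : 0 < k) (hn : 0 < n)
    (s θ β : ℝ) (hs0 : 0 < s) (hs1 : s < 1) (hθ0 : 0 < θ) (hθ1 : θ < 1) (hβ0 : 0 < β)
    (p q r : ℝ≥0∞) (hp : 1 ≤ p) (hq : 1 ≤ q) (hr : 1 ≤ r)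
    (hpqr : p⁻¹ + ENNReal.ofReal s / q ≤ r⁻¹)
    (hβ : β < θ * s ∨
      (β = θ * s ∧ (r = ∞ ∨ (r ≠ ∞ ∧ q = ENNReal.ofReal s * r)))) :
    ∃ c : ℝ → ℝ≥0,
      (∀ R, 0 < c R) ∧
      -- at the endpoint the constant does not depend on the domain at all
      (β = θ * s → ∀ R R', c R = c R') ∧
      ∀ (R : ℝ) (G : Set (EuclideanSpace ℝ (Fin k))),
        IsOpen G → IsConnected G → Bornology.IsBounded G → Metric.diam G ≤ R →
        ∀ (φ : EuclideanSpace ℝ (Fin n) → ℝ)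
          (u : EuclideanSpace ℝ (Fin k) → EuclideanSpace ℝ (Fin n)),
          NonlinearComposition.IsBV φ →
          NonlinearComposition.MemSobolev G θ q u →
          NonlinearComposition.energy G φ s p u < ∞ →
          -- the composition is well defined as an equivalence class
          NonlinearComposition.occupationMeasure G u
              (NonlinearComposition.approxDiscontinuitySet φ) = 0 ∧
          -- the estimate for `φ ∘ u`, the class of `ψ ∘ u` for any Lebesgue representative `ψ`
          ∀ ψ : EuclideanSpace ℝ (Fin n) → ℝ,
            NonlinearComposition.IsLebesgueRepresentative φ ψ →
            (p ≠ ∞ →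
              NonlinearComposition.ClassSeminormLE G β r (fun x => ψ (u x))
                (c R * NonlinearComposition.fracSeminorm G θ q u ^ s *
                  NonlinearComposition.energy G φ s p u ^ (1 / p.toReal))) ∧
            (p = ∞ →
              NonlinearComposition.ClassSeminormLE G β r (fun x => ψ (u x))
                (c R * NonlinearComposition.fracSeminorm G θ q u ^ s *
                  NonlinearComposition.energy G φ s ∞ u)) := by
  obtain ⟨C, -, hC⟩ := NonlinearComposition.exists_enorm_sub_le_rieszPotential hn hs0
  choose c hc0 hc1 hc using fun R : ℝ =>
    NonlinearComposition.exists_const_fracSeminorm_comp_le (n := n) hk hs0 hθ0 hp hq hr hpqr hβ C R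
  refine ⟨c, hc0, fun h R R' => (hc1 R h).trans (hc1 R' h).symm,
    fun R G hG _ hGb hGR φ u hφ hu hV => ⟨?_, fun ψ hψ => ?_⟩⟩
  · exact NonlinearComposition.occupationMeasure_approxDiscontinuitySet hn hs0 hp hφ hu.1 hV
  · have key := hc R G hG hGb hGR φ ψ u hφ hu (hC φ hφ ψ hψ)
    refine ⟨fun h => ?_, fun h => ?_⟩
    · rw [if_neg h] at key
      exact NonlinearComposition.classSeminormLE_of_fracSeminorm_le key
    · rw [if_pos h] at key
      rw [← h]
      exact NonlinearComposition.classSeminormLE_of_fracSeminorm_le key
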